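/- Consider the class of equations $$u_t+x^{2\gamma}u_{xx}+b(x)\,u_x-f(x,u)=0,\qquad b(x)=\alpha+\beta x-\sqrt2\,\lambda x^{\delta},\qquad x>0,\qquad (1)$$ for $u=u(x,t)$ (obtained from the class $u_t+\frac12\rho^2x^{2\gamma}u_{xx}+(\alpha+\beta x-\lambda\rho x^\delta)u_x-f(x,u)=0$, $\rho\neq0$, by rescaling $t$, $\alpha$, $\beta$, $\lambda$, $f$), with arbitrary elements the real parameters $\theta=(\alpha,\beta,\gamma,\delta,\lambda)$ and the function $f$. Let $\Omega\subseteq\mathbb R^5$ be an open set of parameters on which $\gamma\neq1$, $\gamma\ne\frac12$ and $\delta\neq2\gamma-1$. Let $M$ be the set of all $(x,t,u,\alpha,\beta,\gamma,\delta,\lambda,f)\in\mathbb R^9$ with $x>0$ and $\theta\in\Omega$. The (generalized) equivalence algebra of the class (1) over $\Omega$ is the set of all $C^\infty$ vector fields $$X=\xi^1\partial_x+\xi^2\partial_t+\eta\,\partial_u+\eta_\alpha\partial_\alpha+\eta_\beta\partial_\beta+\eta_\gamma\partial_\gamma+\eta_\delta\partial_\delta+\eta_\lambda\partial_\lambda+\eta_f\partial_f$$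 on $M$, with coefficients that may depend on all nine coordinates, whose augmented second prolongation annihilates, modulo the extended system and its differential consequences, every equation of the extended system formed by (1) together with $E_x=E_t=E_u=0$ for $E\in\{\alpha,\beta,\gamma,\delta,\lambda\}$ and $f_t=0$, where $u$ is regarded as a function of $(x,t)$ and $\alpha,\beta,\gamma,\delta,\lambda,f$ as functions of $(x,t,u)$. Theorem. The equivalence algebra of the class (1) over $\Omega$ is generated by the ten families of vector fields below, where $F_i\in C^\infty(\Omega)$ for $i\ne3$ and $F_3\in C^\infty((0,\infty)\times\Omega)$ are arbitrary real functions; precisely, a vector field belongs to the equivalence algebra if and only if it is a sum of one member of each family (the sum is linear in the $F_i$). Write $K=1-2\gamma+\delta$, $F_i=F_i(\theta)$ for $i\neq3$, and $F_3=F_3(x,\theta)$. 1. $F_1\,\partial_t$ 2. $F_2\,(f\partial_f+u\,\partial_u)$ 3. $F_3\,\partial_u+\left(b\,F_{3x}+x^{2\gamma}F_{3xx}\right)\partial_f$ 4. $F_4\Big(\frac{x^{2(1-\gamma)}}{\gamma-1}u\,\partial_u+4\,\partial_\beta+\frac{x^{-2\gamma}}{\gamma-1}\big[fx^2+2(\gamma-1)\big((2\gamma-1)x^{2\gamma}+\sqrt2\lambda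 x^{1+\delta}-\alpha x-\beta x^2\big)u\big]\partial_f\Big)$ 5. $F_5\Big(\frac{x^{1-2\gamma}}{2\gamma-1}u\,\partial_u+2\,\partial_\alpha+\frac{x^{-1-2\gamma}}{2\gamma-1}\big[fx^2+(2\gamma-1)\big(2\gamma x^{2\gamma}+\sqrt2\lambda x^{1+\delta}-\alpha x-\beta x^2\big)u\big]\partial_f\Big)$ 6. $F_6\Big(\frac{\sqrt2x^{K}}{K}u\,\partial_u+2\,\partial_\lambda+\frac{x^{\delta-1-2\gamma}}{K}\big[\sqrt2fx^2+K\big(\sqrt2\alpha x+\sqrt2\beta x^2+\sqrt2x^{2\gamma}(\delta-2\gamma)-2\lambda x^{1+\delta}\big)u\big]\partial_f\Big)$ 7. $F_7\Big(\frac{\sqrt2\lambda x^{K}(K\log x-1)}{K^2}u\,\partial_u+2\,\partial_\delta+\sqrt2\lambda x^{\delta-1}\Big[u-\frac{fx^{2(1-\gamma)}}{K^2}+\frac{x^{-2\gamma}\log x}{K}\big(fx^2+K(\alpha x+\beta x^2+(\delta-2\gamma)x^{2\gamma}-\sqrt2\lambda x^{1+\delta})u\big)\Big]\partial_f\Big)$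 8. $F_8\Big(2x^\gamma\partial_x+ux^{-1-\gamma}\big(\gamma x^{2\gamma}+\sqrt2\lambda x^{1+\delta}-\alpha x-\beta x^2\big)\partial_u+x^{-3-\gamma}\big[f\big(\gamma x^{2(1+\gamma)}+\sqrt2\lambda x^{3+\delta}-\alpha x^3-\beta x^4\big)+u\,P_8\big]\partial_f\Big)$, where $$\begin{aligned}P_8={}&\beta^2(\gamma-1)x^4-2\alpha\gamma x^{1+2\gamma}+\alpha^2\gamma x^2+\alpha\beta(2\gamma-1)x^3+\gamma(2-3\gamma+\gamma^2)x^{4\gamma}\\&-\sqrt2(2\gamma-\delta)(\delta-1)\lambda x^{1+2\gamma+\delta}+\sqrt2\alpha(\delta-2\gamma)\lambda x^{2+\delta}+\sqrt2\beta K\lambda x^{3+\delta}-2(\delta-\gamma)\lambda^2x^{2(1+\delta)}.\end{aligned}$$ 9. $F_9\Big(\frac{2x}{1-\gamma}\partial_x+4t\,\partial_t+\frac{ux^{-2\gamma}}{\gamma-1}\big(\alpha x+\beta x^2+4(\gamma-1)x^{2\gamma}-\sqrt2\lambda x^{1+\delta}\big)\partial_u+\frac{x^{-1-2\gamma}}{\gamma-1}\big[fx^2b-u\,P_9\big]\partial_f\Big)$,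 where $$\begin{aligned}P_9={}&2\beta^2(\gamma-1)x^3+\alpha^2(2\gamma-1)x-2\alpha\gamma(2\gamma-1)x^{2\gamma}+\alpha\beta(4\gamma-3)x^2-2\beta(1-3\gamma+2\gamma^2)x^{1+2\gamma}\\&+\sqrt2\alpha(2-4\gamma+\delta)\lambda x^{1+\delta}+\sqrt2\beta(3-4\gamma+\delta)\lambda x^{2+\delta}+\sqrt2(\delta-2\gamma)K\lambda x^{2\gamma+\delta}-2K\lambda^2x^{1+2\delta}.\end{aligned}$$ 10. $F_{10}\Big(4\,\partial_\gamma-\frac{4x(1+(\gamma-1)\log x)}{(\gamma-1)^2}\partial_x+\frac{x^{-2\gamma}u}{D}\,Q\,\partial_u+\frac{x^{-2(1+\gamma)}}{D}\,R\,\partial_f\Big)$, where $D=(2\gamma-1)^2(\gamma-1)^2K^2$ and $$\begin{aligned}S={}&2\alpha(2\gamma^2-1)K^2+(1-2\gamma)^2\big(\beta K^2x-2\sqrt2(2\gamma^2-4\gamma\delta+\delta^2+2\delta-1)\lambda x^\delta\big),\\ Q={}&xS+2(1-3\gamma+2\gamma^2)K\big((1-2\gamma)Kx^{2\gamma}+\alpha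 Kx-\sqrt2(2\gamma-1)(\delta-1)\lambda x^{1+\delta}\big)\log x,\\ R={}&2u(1-2\gamma)^2K^2\big(\alpha\beta(1-2\gamma)x^3+(\gamma-1)x^{4\gamma}-\beta^2(\gamma-1)x^4+2\beta(\gamma-1)^2x^{2(1+\gamma)}-\alpha^2\gamma x^2\\&\quad+2\alpha(1-\gamma+\gamma^2)x^{1+2\gamma}-\sqrt2\alpha(\delta-2\gamma)\lambda x^{2+\delta}-\sqrt2\beta K\lambda x^{3+\delta}\\&\quad-\sqrt2(2+2\gamma^2-\delta+\delta^2-2\gamma(1+\delta))\lambda x^{1+2\gamma+\delta}+2(\delta-\gamma)\lambda^2x^{2(1+\delta)}\big)+fx^3S\\&+2x(1-3\gamma+2\gamma^2)K\Big[fx\big(-(2\gamma-1)Kx^{2\gamma}+\alpha Kx-\sqrt2(2\gamma-1)(\delta-1)\lambda x^{1+\delta}\big)\\&\quad-u(2\gamma-1)K\big(\alpha^2x+\alpha\beta x^2-2\alpha\gamma x^{2\gamma}+\sqrt2\alpha(\delta-2)\lambda x^{1+\delta}+\sqrt2\beta(\delta-1)\lambda x^{2+\delta}\\&\quad-\sqrt2(2\gamma-\delta)(\delta-1)\lambda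 x^{2\gamma+\delta}-2(\delta-1)\lambda^2x^{1+2\delta}\big)\Big]\log x.\end{aligned}$$ -/

import Mathlib

open scoped ContDiff

namespace BondPricing

/-! ### The extended space

A point of the extended space is `z = (x, t, u, α, β, γ, δ, lam, f)`, in this order, as a vector
`z : Fin 9 → ℝ`; an infinitesimal operator
`ξ¹ ∂_x + ξ² ∂_t + η ∂_u + η_α ∂_α + η_β ∂_β + η_γ ∂_γ + η_δ ∂_δ + η_lam ∂_lam + η_f ∂_f`
is a map `X : (Fin 9 → ℝ) → (Fin 9 → ℝ)` with the components in the same order.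
A parameter vector is `θ = (α, β, γ, δ, lam) : Fin 5 → ℝ`. -/

/-- The parameter vector `(α, β, γ, δ, lam)` of a point of the extended space. -/
def params (z : Fin 9 → ℝ) : Fin 5 → ℝ := ![z 3, z 4, z 5, z 6, z 7]

/-- The part of the extended space with `x > 0` and parameters in `Ω`
(`t`, `u` and `f` are unrestricted). -/
def extDomain (Ω : Set (Fin 5 → ℝ)) : Set (Fin 9 → ℝ) := {z | 0 < z 0 ∧ params z ∈ Ω}

/-- The left-hand side `u_t + x^{2γ} u_xx + (α + β x - √2 lam x^δ) u_x - f` of the equation, as a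
function of the point `z` of the extended space and of the jet coordinates
`ux = u_x`, `ut = u_t`, `uxx = u_xx`. -/
noncomputable def equationLHS (z : Fin 9 → ℝ) (ux ut uxx : ℝ) : ℝ :=
  ut + z 0 ^ (2 * z 5) * uxx + (z 3 + z 4 * z 0 - √2 * z 7 * z 0 ^ z 6) * ux - z 8

/-! ### Functions, arbitrary elements and their graphs -/

/-- The partial derivative with respect to the `i`-th coordinate. -/
noncomputable def pd {n : ℕ} (i : Fin n) (h : (Fin n → ℝ) → ℝ) (p : Fin n → ℝ) : ℝ :=
  fderiv ℝ h p (Pi.single i 1)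

/-- The half space where the first coordinate `x` is positive. -/
def posX (n : ℕ) [NeZero n] : Set (Fin n → ℝ) := {p | 0 < p 0}

/-- The graph of the arbitrary elements `(α, β, γ, δ, lam, f) = a`, all of them regarded as
functions of `q = (x, t, u)`, as a map into the extended space. -/
def graphOf (a : Fin 6 → (Fin 3 → ℝ) → ℝ) (q : Fin 3 → ℝ) : Fin 9 → ℝ :=
  ![q 0, q 1, q 2, a 0 q, a 1 q, a 2 q, a 3 q, a 4 q, a 5 q]

/-- The point of the extended space over `p = (x, t)` that is determined by a function `u(x, t)`
and arbitrary elements `a`. -/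
def sectionOf (u : (Fin 2 → ℝ) → ℝ) (a : Fin 6 → (Fin 3 → ℝ) → ℝ) (p : Fin 2 → ℝ) : Fin 9 → ℝ :=
  graphOf a ![p 0, p 1, u p]

/-- The auxiliary part of the extended system: `α, β, γ, δ, lam, f` are smooth functions of
`(x, t, u)`, `x > 0`, all first derivatives of `α, β, γ, δ, lam` vanish identically, and so does
`f_t`. The values of the parameters lie in `Ω`. -/
structure IsAdmissible (Ω : Set (Fin 5 → ℝ)) (a : Fin 6 → (Fin 3 → ℝ) → ℝ) : Prop where
  smooth : ∀ i, ContDiffOn ℝ ∞ (a i) (posX 3)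
  mem : ∀ q ∈ posX 3, params (graphOf a q) ∈ Ω
  param_const : ∀ i : Fin 5, ∀ v : Fin 3, ∀ q ∈ posX 3, pd v (a i.castSucc) q = 0
  source_t : ∀ q ∈ posX 3, pd 1 (a 5) q = 0

/-! ### The augmented second prolongation

Total derivatives are evaluated as partial derivatives of the composition with the graph: `D_x`,
`D_t` of a function on the extended space are the derivatives of its composition with
`sectionOf u a`, and the total derivatives belonging to the arbitrary elements (which are functions
of `(x, t, u)`) are the derivatives of its composition with `graphOf a`. -/

/-- The coefficient of `∂_{u_i}` in the prolongation (`i = 0` for `x`, `i = 1` for `t`):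
`ζ^i = D_i η - u_x D_i ξ¹ - u_t D_i ξ²`. -/
noncomputable def zeta1 (X : (Fin 9 → ℝ) → (Fin 9 → ℝ)) (u : (Fin 2 → ℝ) → ℝ)
    (a : Fin 6 → (Fin 3 → ℝ) → ℝ) (i : Fin 2) (p : Fin 2 → ℝ) : ℝ :=
  pd i (fun p' => X (sectionOf u a p') 2) p
    - pd 0 u p * pd i (fun p' => X (sectionOf u a p') 0) p
    - pd 1 u p * pd i (fun p' => X (sectionOf u a p') 1) p

/-- The coefficient of `∂_{u_ij}` in the prolongation:
`ζ^{ij} = D_j ζ^i - u_{ix} D_j ξ¹ - u_{it} D_j ξ²`. -/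
noncomputable def zeta2 (X : (Fin 9 → ℝ) → (Fin 9 → ℝ)) (u : (Fin 2 → ℝ) → ℝ)
    (a : Fin 6 → (Fin 3 → ℝ) → ℝ) (i j : Fin 2) (p : Fin 2 → ℝ) : ℝ :=
  pd j (zeta1 X u a i) p
    - pd 0 (pd i u) p * pd j (fun p' => X (sectionOf u a p') 0) p
    - pd 1 (pd i u) p * pd j (fun p' => X (sectionOf u a p') 1) p

/-- The coefficient of `∂_{E_v}` in the augmented prolongation, where `E` is the `i`-th arbitrary
element and `v` is one of `x, t, u`:
`μ^{E,v} = D_v η_E - E_x D_v ξ¹ - E_t D_v ξ² - E_u D_v η`. -/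
noncomputable def mu (X : (Fin 9 → ℝ) → (Fin 9 → ℝ)) (a : Fin 6 → (Fin 3 → ℝ) → ℝ)
    (i : Fin 6) (v : Fin 3) (q : Fin 3 → ℝ) : ℝ :=
  pd v (fun q' => X (graphOf a q') (Fin.natAdd 3 i)) q
    - ∑ w : Fin 3, pd w (a i) q * pd v (fun q' => X (graphOf a q') (Fin.castAdd 6 w)) q

/-- The prolonged operator applied to the left-hand side of the equation, at the jet of `u` and `a`
over `p`: the derivative of `equationLHS` in the direction `(X, ζ^x, ζ^t, ζ^{xx})`. -/
noncomputable def prolongedAction (X : (Fin 9 → ℝ) → (Fin 9 → ℝ)) (u : (Fin 2 → ℝ) → ℝ)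
    (a : Fin 6 → (Fin 3 → ℝ) → ℝ) (p : Fin 2 → ℝ) : ℝ :=
  deriv (fun ε : ℝ => equationLHS (sectionOf u a p + ε • X (sectionOf u a p))
    (pd 0 u p + ε * zeta1 X u a 0 p) (pd 1 u p + ε * zeta1 X u a 1 p)
    (pd 0 (pd 0 u) p + ε * zeta2 X u a 0 0 p)) 0

/-- Membership in the (generalized) equivalence algebra over the parameter set `Ω`: the smooth operators `X` on
the extended space, with all coefficients depending on all of `(x, t, u, α, β, γ, δ, lam, f)`,
whose augmented second prolongation annihilates each equation of the extended system
`u_t + x^{2γ} u_xx + (α + β x - √2 lam x^δ) u_x - f = 0`, `E_x = E_t = E_u = 0` for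
`E = α, β, γ, δ, lam`, and `f_t = 0`, modulo the extended system. -/
structure IsEquivalenceOperator (Ω : Set (Fin 5 → ℝ)) (X : (Fin 9 → ℝ) → (Fin 9 → ℝ)) :
    Prop where
  smooth : ContDiffOn ℝ ∞ X (extDomain Ω)
  equation : ∀ a, IsAdmissible Ω a → ∀ u : (Fin 2 → ℝ) → ℝ, ContDiffOn ℝ ∞ u (posX 2) →
    ∀ p ∈ posX 2, equationLHS (sectionOf u a p) (pd 0 u p) (pd 1 u p) (pd 0 (pd 0 u) p) = 0 →
      prolongedAction X u a p = 0
  param : ∀ a, IsAdmissible Ω a → ∀ i : Fin 5, ∀ v : Fin 3, ∀ q ∈ posX 3,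
    mu X a i.castSucc v q = 0
  source : ∀ a, IsAdmissible Ω a → ∀ q ∈ posX 3, mu X a 5 1 q = 0

/-- The set of all equivalence operators over the parameter set `Ω`. -/
def equivalenceAlgebra (Ω : Set (Fin 5 → ℝ)) : Set ((Fin 9 → ℝ) → (Fin 9 → ℝ)) :=
  {X | IsEquivalenceOperator Ω X}

/-! ### The ten families of vector fields

Components in the order `∂_x, ∂_t, ∂_u, ∂_α, ∂_β, ∂_γ, ∂_δ, ∂_lam, ∂_f`. -/

noncomputable def field1 (F : (Fin 5 → ℝ) → ℝ) (z : Fin 9 → ℝ) : Fin 9 → ℝ :=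
  F (params z) • ![0, 1, 0, 0, 0, 0, 0, 0, 0]

noncomputable def field2 (F : (Fin 5 → ℝ) → ℝ) (z : Fin 9 → ℝ) : Fin 9 → ℝ :=
  F (params z) • ![0, 0, z 2, 0, 0, 0, 0, 0, z 8]

noncomputable def field3 (F : ℝ × (Fin 5 → ℝ) → ℝ) (z : Fin 9 → ℝ) : Fin 9 → ℝ :=
  ![0, 0, F (z 0, params z), 0, 0, 0, 0, 0,
    (z 3 + z 4 * z 0 - √2 * z 7 * z 0 ^ z 6) * deriv (fun y => F (y, params z)) (z 0)
      + z 0 ^ (2 * z 5) * deriv (deriv (fun y => F (y, params z))) (z 0)]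

/-- Evaluate a vector given by a formula in the nine coordinates at a point. -/
def atPoint (v : ℝ → ℝ → ℝ → ℝ → ℝ → ℝ → ℝ → ℝ → ℝ → (Fin 9 → ℝ)) (z : Fin 9 → ℝ) :
    Fin 9 → ℝ :=
  v (z 0) (z 1) (z 2) (z 3) (z 4) (z 5) (z 6) (z 7) (z 8)

noncomputable def vec4 (x _t u α β γ δ lam f : ℝ) : Fin 9 → ℝ :=
  ![0, 0, x ^ (2 * (1 - γ)) / (γ - 1) * u, 0, 4, 0, 0, 0,
    x ^ (-2 * γ) * (f * x ^ 2 + 2 * (γ - 1) * ((2 * γ - 1) * x ^ (2 * γ)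
      + √2 * lam * x ^ (1 + δ) - α * x - β * x ^ 2) * u) / (γ - 1)]

noncomputable def vec5 (x _t u α β γ δ lam f : ℝ) : Fin 9 → ℝ :=
  ![0, 0, x ^ (1 - 2 * γ) / (2 * γ - 1) * u, 2, 0, 0, 0, 0,
    x ^ (-1 - 2 * γ) * (f * x ^ 2 + (2 * γ - 1) * (2 * γ * x ^ (2 * γ)
      + √2 * lam * x ^ (1 + δ) - α * x - β * x ^ 2) * u) / (2 * γ - 1)]

noncomputable def vec6 (x _t u α β γ δ lam f : ℝ) : Fin 9 → ℝ :=
  ![0, 0, √2 * x ^ (1 - 2 * γ + δ) / (1 - 2 * γ + δ) * u, 0, 0, 0, 0, 2,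
    x ^ (δ - 1 - 2 * γ) / (δ + 1 - 2 * γ) * (√2 * f * x ^ 2
      + (δ + 1 - 2 * γ) * (√2 * α * x + √2 * β * x ^ 2 + √2 * x ^ (2 * γ) * (δ - 2 * γ)
        - 2 * lam * x ^ (1 + δ)) * u)]

noncomputable def vec7 (x _t u α β γ δ lam f : ℝ) : Fin 9 → ℝ :=
  ![0, 0,
    √2 * lam * x ^ (1 - 2 * γ + δ) * ((1 - 2 * γ + δ) * Real.log x - 1)
      / (1 - 2 * γ + δ) ^ 2 * u,
    0, 0, 0, 2, 0,
    √2 * lam * x ^ (-1 + δ) * ((u - f * x ^ (2 * (1 - γ)) / (1 - 2 * γ + δ) ^ 2)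
      + x ^ (-2 * γ) * Real.log x / (1 - 2 * γ + δ) * (f * x ^ 2
        + (1 - 2 * γ + δ) * (α * x + β * x ^ 2 + (δ - 2 * γ) * x ^ (2 * γ)
          - √2 * lam * x ^ (1 + δ)) * u))]

noncomputable def vec8 (x _t u α β γ δ lam f : ℝ) : Fin 9 → ℝ :=
  ![2 * x ^ γ, 0,
    u * x ^ (-1 - γ) * (γ * x ^ (2 * γ) + √2 * lam * x ^ (1 + δ) - α * x - β * x ^ 2),
    0, 0, 0, 0, 0,
    x ^ (-3 - γ) * (
      f * (γ * x ^ (2 * (1 + γ)) + √2 * lam * x ^ (3 + δ) - α * x ^ 3 - β * x ^ 4)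
      + u * (β ^ 2 * (γ - 1) * x ^ 4 - 2 * α * γ * x ^ (1 + 2 * γ) + α ^ 2 * γ * x ^ 2
        + α * β * (2 * γ - 1) * x ^ 3 + γ * (2 - 3 * γ + γ ^ 2) * x ^ (4 * γ)
        - √2 * (2 * γ - δ) * (δ - 1) * lam * x ^ (1 + 2 * γ + δ)
        + √2 * α * (δ - 2 * γ) * lam * x ^ (2 + δ)
        + √2 * β * (1 - 2 * γ + δ) * lam * x ^ (3 + δ)
        - 2 * (δ - γ) * lam ^ 2 * x ^ (2 * (1 + δ))))]

noncomputable def vec9 (x t u α β γ δ lam f : ℝ) : Fin 9 → ℝ :=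
  ![2 * x / (1 - γ), 4 * t,
    u * x ^ (-2 * γ) * (α * x + β * x ^ 2 + 4 * (γ - 1) * x ^ (2 * γ)
      - √2 * lam * x ^ (1 + δ)) / (γ - 1),
    0, 0, 0, 0, 0,
    x ^ (-1 - 2 * γ) / (γ - 1) * (f * x ^ 2 * (α + β * x - √2 * lam * x ^ δ)
      - u * (2 * β ^ 2 * (γ - 1) * x ^ 3 + α ^ 2 * (2 * γ - 1) * x
        - 2 * α * γ * (2 * γ - 1) * x ^ (2 * γ) + α * β * (4 * γ - 3) * x ^ 2
        - 2 * β * (1 - 3 * γ + 2 * γ ^ 2) * x ^ (1 + 2 * γ)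
        + √2 * α * (2 - 4 * γ + δ) * lam * x ^ (1 + δ)
        + √2 * β * (3 - 4 * γ + δ) * lam * x ^ (2 + δ)
        + √2 * (δ - 2 * γ) * (δ - 2 * γ + 1) * lam * x ^ (2 * γ + δ)
        - 2 * (1 - 2 * γ + δ) * lam ^ 2 * x ^ (1 + 2 * δ)))]

noncomputable def vec10 (x _t u α β γ δ lam f : ℝ) : Fin 9 → ℝ :=
  ![-(4 * x * (1 + (γ - 1) * Real.log x) / (γ - 1) ^ 2), 0,
    x ^ (-2 * γ) * u / ((2 * γ - 1) ^ 2 * (γ - 1) ^ 2 * (1 - 2 * γ + δ) ^ 2) * (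
      x * (2 * α * (2 * γ ^ 2 - 1) * (1 - 2 * γ + δ) ^ 2
        + (1 - 2 * γ) ^ 2 * (β * (1 - 2 * γ + δ) ^ 2 * x
          - 2 * √2 * (2 * γ ^ 2 + δ * (2 - 4 * γ + δ) - 1) * lam * x ^ δ))
      + 2 * (1 - 3 * γ + 2 * γ ^ 2) * (1 - 2 * γ + δ) * (
          (1 - 2 * γ) * (1 - 2 * γ + δ) * x ^ (2 * γ) + α * (1 - 2 * γ + δ) * x
          - √2 * (2 * γ - 1) * (δ - 1) * lam * x ^ (1 + δ)) * Real.log x),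
    0, 0, 4, 0, 0,
    x ^ (-2 * (1 + γ)) / ((2 * γ - 1) ^ 2 * (γ - 1) ^ 2 * (1 - 2 * γ + δ) ^ 2) * (
      2 * u * (1 - 2 * γ) ^ 2 * (1 - 2 * γ + δ) ^ 2 * (
        α * β * (1 - 2 * γ) * x ^ 3 + (γ - 1) * x ^ (4 * γ)
        - β ^ 2 * (γ - 1) * x ^ 4 + 2 * β * (γ - 1) ^ 2 * x ^ (2 * (1 + γ))
        - α ^ 2 * γ * x ^ 2 + 2 * α * (1 - γ + γ ^ 2) * x ^ (1 + 2 * γ)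
        - √2 * α * (δ - 2 * γ) * lam * x ^ (2 + δ)
        - √2 * β * (1 - 2 * γ + δ) * lam * x ^ (3 + δ)
        - √2 * (2 + 2 * γ ^ 2 - δ + δ ^ 2 - 2 * γ * (1 + δ)) * lam * x ^ (1 + 2 * γ + δ)
        + 2 * (δ - γ) * lam ^ 2 * x ^ (2 * (1 + δ)))
      + f * x ^ 3 * (2 * α * (2 * γ ^ 2 - 1) * (1 - 2 * γ + δ) ^ 2
        + (1 - 2 * γ) ^ 2 * (β * (1 - 2 * γ + δ) ^ 2 * x
          - 2 * √2 * (-1 + 2 * γ ^ 2 + 2 * δ - 4 * γ * δ + δ ^ 2) * lam * x ^ δ))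
      - 2 * x * (1 - 3 * γ + 2 * γ ^ 2) * (2 * γ - δ - 1) * (
        f * x * ((2 * γ - 1) * (2 * γ - δ - 1) * x ^ (2 * γ) + α * (1 - 2 * γ + δ) * x
          - √2 * (2 * γ - 1) * (δ - 1) * lam * x ^ (1 + δ))
        + u * (2 * γ - 1) * (2 * γ - δ - 1) * (α ^ 2 * x + α * β * x ^ 2
          - 2 * α * γ * x ^ (2 * γ) + √2 * α * (δ - 2) * lam * x ^ (1 + δ)
          + √2 * β * (δ - 1) * lam * x ^ (2 + δ)
          - √2 * (2 * γ - δ) * (δ - 1) * lam * x ^ (2 * γ + δ)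
          - 2 * (δ - 1) * lam ^ 2 * x ^ (1 + 2 * δ))) * Real.log x)]

/-- The family `F(α, β, γ, δ, lam) v`, with `v` given by a formula in the coordinates. -/
def fieldOf (v : ℝ → ℝ → ℝ → ℝ → ℝ → ℝ → ℝ → ℝ → ℝ → (Fin 9 → ℝ)) (F : (Fin 5 → ℝ) → ℝ)
    (z : Fin 9 → ℝ) : Fin 9 → ℝ :=
  F (params z) • atPoint v z

end BondPricing

namespace BondPricing

open Filter Topology

/-! The auxiliary equations force the parameters to be constants, so every admissible tuple lies
over one `θ ∈ Ω` and the invariance condition decouples into separate problems on the fibres `(x, t,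
u, f)`. The fibres are coupled only by smoothness in `θ`.

On a fibre, necessity is the Lie splitting procedure. Quadratic test functions `u` and sources `f`
realise every jet that occurs, with `u_t` eliminated by the equation. Comparing coefficients of the
free jet variables gives the normal form `ξ(x) ∂_x + τ(t) ∂_t + (φ(x) u + ψ(x)) ∂_u` plus constants
`e` along the parameters. What remains is affine in `u_x` and `u_xx`. The `u_xx` coefficient gives
`τ' - 2 ξ' + 2 γ ξ / x + 2 e_γ log x = 0`, the `u_x` coefficient expresses `φ'` through `ξ`, `τ'`
and `e`, and the constant term gives `η_f`. Conversely these relations make the prolonged action a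
combination of the equation and zeros. This equivalence is `isEquivalenceOperator_iff`.

The fibre system is linear. Its solutions have five constants `e`, two in `τ` (`τ'` must be
constant), one in `ξ` (a first-order linear equation with homogeneous solution `x^γ`), one in `φ`,
and the free function `ψ`. Families 4, 5, 6, 7 and 10 realise the five parameter directions, 1 and 9
realise `τ`, 8 realises the homogeneous `ξ`. Subtracting the matching combination leaves an operator
with `ξ = τ = 0` and `e = 0`, hence `φ` constant, which is a sum of families 2 and 3
(`IsFiberSolution.eq_of_normalized`). All coefficients are values of `X` at fixed points of the
fibre, corrected by smooth fields, so they are smooth in `θ`.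

The exclusions on `Ω` keep the integrals of `x^(1 - 2γ)`, `x^(-2γ)` and `x^(δ - 2γ)` that define `φ`
from degenerating into logarithms: the denominators are `γ - 1`, `2γ - 1` and `K`. -/

theorem isOpen_posX (n : ℕ) [NeZero n] : IsOpen (posX n) :=
  isOpen_lt continuous_const (continuous_apply 0)

theorem posX_mem_nhds {n : ℕ} [NeZero n] {p : Fin n → ℝ} (hp : p ∈ posX n) : posX n ∈ 𝓝 p :=
  (isOpen_posX n).mem_nhds hp

/-! ### Calculus of partial derivatives on the half space. -/

section PartialDerivatives

variable {n : ℕ}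

theorem pd_congr_of_eventuallyEq {i : Fin n} {g h : (Fin n → ℝ) → ℝ} {p : Fin n → ℝ}
    (hgh : g =ᶠ[𝓝 p] h) : pd i g p = pd i h p := by
  rw [pd, pd, hgh.fderiv_eq]

theorem pd_congr [NeZero n] {i : Fin n} {g h : (Fin n → ℝ) → ℝ} {p : Fin n → ℝ}
    (hp : p ∈ posX n) (hgh : ∀ q ∈ posX n, g q = h q) : pd i g p = pd i h p :=
  pd_congr_of_eventuallyEq (eventually_of_mem (posX_mem_nhds hp) hgh)

theorem pd_add {i : Fin n} {g h : (Fin n → ℝ) → ℝ} {p : Fin n → ℝ}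
    (hg : DifferentiableAt ℝ g p) (hh : DifferentiableAt ℝ h p) :
    pd i (fun q => g q + h q) p = pd i g p + pd i h p := by
  simp [pd, fderiv_fun_add hg hh]

theorem pd_sub {i : Fin n} {g h : (Fin n → ℝ) → ℝ} {p : Fin n → ℝ}
    (hg : DifferentiableAt ℝ g p) (hh : DifferentiableAt ℝ h p) :
    pd i (fun q => g q - h q) p = pd i g p - pd i h p := by
  simp [pd, fderiv_fun_sub hg hh]

theorem pd_mul {i : Fin n} {g h : (Fin n → ℝ) → ℝ} {p : Fin n → ℝ}
    (hg : DifferentiableAt ℝ g p) (hh : DifferentiableAt ℝ h p) :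
    pd i (fun q => g q * h q) p = g p * pd i h p + h p * pd i g p := by
  simp [pd, fderiv_fun_mul hg hh]

theorem pd_const (i : Fin n) (c : ℝ) (p : Fin n → ℝ) : pd i (fun _ => c) p = 0 := by
  simp [pd]

theorem differentiableAt_comp_coord {g : ℝ → ℝ} {g' : ℝ} {j : Fin n} {p : Fin n → ℝ}
    (hg : HasDerivAt g g' (p j)) : DifferentiableAt ℝ (fun q : Fin n → ℝ => g (q j)) p :=
  hg.differentiableAt.comp p (differentiableAt_apply j p)

theorem pd_comp_coord {g : ℝ → ℝ} {g' : ℝ} {j : Fin n} {p : Fin n → ℝ}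
    (hg : HasDerivAt g g' (p j)) (i : Fin n) :
    pd i (fun q => g (q j)) p = if i = j then g' else 0 := by
  have h1 : HasFDerivAt (fun q : Fin n → ℝ => q j) (ContinuousLinearMap.proj (R := ℝ) j) p :=
    hasFDerivAt_apply j p
  have h2 := hg.comp_hasFDerivAt p h1
  rw [pd, show (fun q : Fin n → ℝ => g (q j)) = g ∘ fun q : Fin n → ℝ => q j from rfl, h2.fderiv]
  rcases eq_or_ne i j with rfl | hij
  · simp
  · simp [hij, Ne.symm hij]

/-- The partial derivative is the derivative along the coordinate line. -/
theorem hasDerivAt_coordLine {i : Fin n} {g : (Fin n → ℝ) → ℝ} {p : Fin n → ℝ}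
    (hg : DifferentiableAt ℝ g p) :
    HasDerivAt (fun s => g (Function.update p i s)) (pd i g p) (p i) := by
  have h1 : HasDerivAt (Function.update p i) (Pi.single i 1) (p i) := hasDerivAt_update p i (p i)
  have h2 : HasFDerivAt g (fderiv ℝ g p) (Function.update p i (p i)) := by
    rw [Function.update_eq_self]; exact hg.hasFDerivAt
  exact h2.comp_hasDerivAt (p i) h1

theorem contDiffOn_pd [NeZero n] {g : (Fin n → ℝ) → ℝ} (hg : ContDiffOn ℝ ∞ g (posX n))
    (i : Fin n) : ContDiffOn ℝ ∞ (pd i g) (posX n) :=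
  (hg.fderiv_of_isOpen (m := ∞) (isOpen_posX n) (by simp)).clm_apply contDiffOn_const

theorem differentiableAt_of_posX [NeZero n] {g : (Fin n → ℝ) → ℝ}
    (hg : ContDiffOn ℝ ∞ g (posX n)) {p : Fin n → ℝ} (hp : p ∈ posX n) :
    DifferentiableAt ℝ g p :=
  (hg.contDiffAt (posX_mem_nhds hp)).differentiableAt (by simp)

end PartialDerivatives

/-! ### The prolongation in terms of the coefficients along a section -/

/-- A coefficient of the operator along the section given by `u` and `a`. -/
noncomputable def alongSection (X : (Fin 9 → ℝ) → (Fin 9 → ℝ)) (u : (Fin 2 → ℝ) → ℝ)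
    (a : Fin 6 → (Fin 3 → ℝ) → ℝ) (i : Fin 9) (p : Fin 2 → ℝ) : ℝ :=
  X (sectionOf u a p) i

/-- Leibniz rule for `D_x ζ^x`. One mixed derivative of `u` comes from the Leibniz rule and the
other from the correction term of `zeta2`; keeping them apart avoids any appeal to their symmetry.
-/
theorem zeta2_eq {X : (Fin 9 → ℝ) → (Fin 9 → ℝ)} {u : (Fin 2 → ℝ) → ℝ}
    {a : Fin 6 → (Fin 3 → ℝ) → ℝ} (hu : ContDiffOn ℝ ∞ u (posX 2))
    (hX : ∀ i, ContDiffOn ℝ ∞ (alongSection X u a i) (posX 2)) {p : Fin 2 → ℝ}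
    (hp : p ∈ posX 2) :
    zeta2 X u a 0 0 p = pd 0 (pd 0 (alongSection X u a 2)) p
      - pd 0 u p * pd 0 (pd 0 (alongSection X u a 0)) p
      - pd 1 u p * pd 0 (pd 0 (alongSection X u a 1)) p
      - 2 * pd 0 (pd 0 u) p * pd 0 (alongSection X u a 0) p
      - (pd 0 (pd 1 u) p + pd 1 (pd 0 u) p) * pd 0 (alongSection X u a 1) p := by
  have d {g : (Fin 2 → ℝ) → ℝ} (hg : ContDiffOn ℝ ∞ g (posX 2)) (i : Fin 2) :
      DifferentiableAt ℝ (pd i g) p := differentiableAt_of_posX (contDiffOn_pd hg i) hp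
  have h : pd 0 (zeta1 X u a 0) p = pd 0 (fun q => pd 0 (alongSection X u a 2) q
      - pd 0 u q * pd 0 (alongSection X u a 0) q
      - pd 1 u q * pd 0 (alongSection X u a 1) q) p := rfl
  have e (i : Fin 9) : pd 0 (fun p' => X (sectionOf u a p') i) p
    = pd 0 (alongSection X u a i) p := rfl
  rw [zeta2, h, e, e, pd_sub, pd_sub, pd_mul (d hu 0) (d (hX 0) 0), pd_mul (d hu 1) (d (hX 1) 0)]
  · ring
  · exact d (hX 2) 0
  · exact (d hu 0).mul (d (hX 0) 0)
  · exact (d (hX 2) 0).sub ((d hu 0).mul (d (hX 0) 0))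
  · exact (d hu 1).mul (d (hX 1) 0)

/-- The derivative of the left-hand side of the equation in a given direction. -/
theorem prolongedAction_eq (X : (Fin 9 → ℝ) → (Fin 9 → ℝ)) (u : (Fin 2 → ℝ) → ℝ)
    (a : Fin 6 → (Fin 3 → ℝ) → ℝ) {p : Fin 2 → ℝ} (hp : p ∈ posX 2) {z v : Fin 9 → ℝ}
    (hz : sectionOf u a p = z) (hv : X z = v) :
    prolongedAction X u a p = zeta1 X u a 1 p + z 0 ^ (2 * z 5) * zeta2 X u a 0 0 p
      + (z 3 + z 4 * z 0 - √2 * z 7 * z 0 ^ z 6) * zeta1 X u a 0 p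
      + z 0 ^ (2 * z 5) * (2 * z 5 * (v 0 / z 0) + 2 * v 5 * Real.log (z 0)) * pd 0 (pd 0 u) p
      + (v 3 + v 4 * z 0 + z 4 * v 0 - √2 * z 0 ^ z 6 * (v 7
        + z 7 * (z 6 * (v 0 / z 0) + v 6 * Real.log (z 0)))) * pd 0 u p - v 8 := by
  have hx : 0 < z 0 := by rw [← hz]; exact hp
  rw [prolongedAction, hz, hv]
  have l (i : Fin 9) : HasDerivAt (fun ε : ℝ => z i + ε * v i) (v i) 0 := by
    simpa using ((hasDerivAt_id (0 : ℝ)).mul_const (v i)).const_add (z i)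
  have m (r s : ℝ) : HasDerivAt (fun ε : ℝ => r + ε * s) s 0 := by
    simpa using ((hasDerivAt_id (0 : ℝ)).mul_const s).const_add r
  have h0 : 0 < z 0 + 0 * v 0 := by simpa using hx
  -- Base and exponent both move with `ε`. The moving exponent is the source of every `log x` in the
  -- determining equations.
  have r1 := (l 0).rpow ((l 5).const_mul 2) h0
  have r2 := (l 0).rpow (l 6) h0
  have key := ((((m (pd 1 u p) (zeta1 X u a 1 p)).add
    (r1.mul (m (pd 0 (pd 0 u) p) (zeta2 X u a 0 0 p)))).add
    ((((l 3).add ((l 4).mul (l 0))).sub (((l 7).const_mul √2).mul r2)).mul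
      (m (pd 0 u p) (zeta1 X u a 0 p)))).sub (l 8)).deriv
  simp only [equationLHS, Pi.add_apply, Pi.smul_apply, smul_eq_mul]
  refine Eq.trans key ?_
  simp only [zero_mul, add_zero]
  rw [Real.rpow_sub_one hx.ne', Real.rpow_sub_one hx.ne']
  field_simp
  simp
  ring

/-! ### Fibres of the extended space over a parameter vector -/

/-- The point `(x, t, u, θ, f)` of the extended space. -/
def fiberPt (θ : Fin 5 → ℝ) (x t u f : ℝ) : Fin 9 → ℝ :=
  ![x, t, u, θ 0, θ 1, θ 2, θ 3, θ 4, f]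

@[simp] theorem params_fiberPt (θ : Fin 5 → ℝ) (x t u f : ℝ) : params (fiberPt θ x t u f) = θ := by
  ext i; fin_cases i <;> rfl

theorem fiberPt_params (z : Fin 9 → ℝ) : fiberPt (params z) (z 0) (z 1) (z 2) (z 8) = z := by
  ext i; fin_cases i <;> rfl

theorem fiberPt_mem {Ω : Set (Fin 5 → ℝ)} {θ : Fin 5 → ℝ} (hθ : θ ∈ Ω) {x : ℝ} (hx : 0 < x)
    (t u f : ℝ) : fiberPt θ x t u f ∈ extDomain Ω :=
  ⟨hx, by simpa using hθ⟩

theorem contDiff_params : ContDiff ℝ ∞ params := by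
  rw [contDiff_pi]
  intro i
  fin_cases i <;> exact contDiff_apply ℝ ℝ _

theorem isOpen_extDomain {Ω : Set (Fin 5 → ℝ)} (hΩ : IsOpen Ω) : IsOpen (extDomain Ω) :=
  (isOpen_lt continuous_const (continuous_apply 0)).inter
    (hΩ.preimage contDiff_params.continuous)

theorem isPreconnected_posX (n : ℕ) [NeZero n] : IsPreconnected (posX n) :=
  (convex_halfSpace_gt (f := fun p : Fin n → ℝ => p 0) ⟨fun _ _ => rfl, fun _ _ => rfl⟩
    0).isPreconnected

theorem exists_const_of_pd_eq_zero {n : ℕ} [NeZero n] {g : (Fin n → ℝ) → ℝ}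
    (hg : ContDiffOn ℝ ∞ g (posX n)) (h : ∀ i, ∀ p ∈ posX n, pd i g p = 0) :
    ∃ c, ∀ p ∈ posX n, g p = c := by
  refine (isOpen_posX n).exists_is_const_of_fderiv_eq_zero (𝕜 := ℝ) (isPreconnected_posX n)
    (hg.differentiableOn (by simp)) ?_
  intro p hp
  refine ContinuousLinearMap.coe_injective (LinearMap.pi_ext' fun i => ?_)
  ext
  simpa [pd] using h i p hp

/-- The half space is connected, so vanishing derivatives make the parameters constant. This is what
allows the analysis to proceed one fibre at a time. -/
theorem IsAdmissible.exists_params {Ω : Set (Fin 5 → ℝ)} {a : Fin 6 → (Fin 3 → ℝ) → ℝ}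
    (ha : IsAdmissible Ω a) : ∃ θ ∈ Ω, ∀ q ∈ posX 3, ∀ i : Fin 5, a i.castSucc q = θ i := by
  choose θ hθ using fun i : Fin 5 =>
    exists_const_of_pd_eq_zero (ha.smooth i.castSucc) (ha.param_const i)
  refine ⟨θ, ?_, fun q hq i => hθ i q hq⟩
  have h1 : (fun _ => 1 : Fin 3 → ℝ) ∈ posX 3 := one_pos (α := ℝ)
  convert ha.mem _ h1
  ext i
  rw [← hθ i _ h1]
  fin_cases i <;> rfl

theorem graphOf_eq_fiberPt {a : Fin 6 → (Fin 3 → ℝ) → ℝ} {θ : Fin 5 → ℝ}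
    {q : Fin 3 → ℝ} (hθ : ∀ i : Fin 5, a i.castSucc q = θ i) :
    graphOf a q = fiberPt θ (q 0) (q 1) (q 2) (a 5 q) := by
  have h0 := hθ 0; have h1 := hθ 1; have h2 := hθ 2; have h3 := hθ 3; have h4 := hθ 4
  change ![q 0, q 1, q 2, a 0 q, a 1 q, a 2 q, a 3 q, a 4 q, a 5 q] = _
  rw [show a 0 q = θ 0 from h0, show a 1 q = θ 1 from h1, show a 2 q = θ 2 from h2,
    show a 3 q = θ 3 from h3, show a 4 q = θ 4 from h4]
  rfl

theorem contDiffOn_graphOf {a : Fin 6 → (Fin 3 → ℝ) → ℝ}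
    (ha : ∀ i, ContDiffOn ℝ ∞ (a i) (posX 3)) : ContDiffOn ℝ ∞ (graphOf a) (posX 3) := by
  rw [contDiffOn_pi]
  intro i
  fin_cases i
  · exact (contDiff_apply ℝ ℝ (0 : Fin 3)).contDiffOn
  · exact (contDiff_apply ℝ ℝ (1 : Fin 3)).contDiffOn
  · exact (contDiff_apply ℝ ℝ (2 : Fin 3)).contDiffOn
  · exact ha 0
  · exact ha 1
  · exact ha 2
  · exact ha 3
  · exact ha 4
  · exact ha 5

theorem contDiffOn_sectionOf {a : Fin 6 → (Fin 3 → ℝ) → ℝ} {u : (Fin 2 → ℝ) → ℝ}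
    (ha : ∀ i, ContDiffOn ℝ ∞ (a i) (posX 3)) (hu : ContDiffOn ℝ ∞ u (posX 2)) :
    ContDiffOn ℝ ∞ (sectionOf u a) (posX 2) := by
  have h : ContDiffOn ℝ ∞ (fun p : Fin 2 → ℝ => ![p 0, p 1, u p]) (posX 2) := ?_
  · exact (contDiffOn_graphOf ha).comp h fun p hp => hp
  rw [contDiffOn_pi]
  intro i
  fin_cases i
  · exact (contDiff_apply ℝ ℝ (0 : Fin 2)).contDiffOn
  · exact (contDiff_apply ℝ ℝ (1 : Fin 2)).contDiffOn
  · exact hu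

theorem contDiffOn_alongSection {Ω : Set (Fin 5 → ℝ)} {X : (Fin 9 → ℝ) → (Fin 9 → ℝ)}
    (hX : ContDiffOn ℝ ∞ X (extDomain Ω)) {a : Fin 6 → (Fin 3 → ℝ) → ℝ} {u : (Fin 2 → ℝ) → ℝ}
    (ha : IsAdmissible Ω a) (hu : ContDiffOn ℝ ∞ u (posX 2)) (i : Fin 9) :
    ContDiffOn ℝ ∞ (alongSection X u a i) (posX 2) :=
  (contDiffOn_pi.1 hX i).comp (contDiffOn_sectionOf ha.smooth hu) fun p hp =>
    ⟨hp, ha.mem ![p 0, p 1, u p] hp⟩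

/-! ### The determining equations on a fibre -/

/-- Candidates for the coefficients of an operator on a fibre:
`ξ(x) ∂_x + τ(t) ∂_t + (φ(x) u + ψ(x)) ∂_u + ∑ eᵢ ∂_{θᵢ}`, with their derivatives. -/
structure FiberCoeffs where
  (ξ ξ₁ ξ₂ τ τ₁ φ φ₁ φ₂ ψ ψ₁ ψ₂ : ℝ → ℝ)
  e : Fin 5 → ℝ

/-- The coefficients of `∂_x, ∂_t, ∂_u, ∂_θ` on a fibre are those given by `C`. -/
structure FiberCoeffs.Represents (C : FiberCoeffs) (Z : ℝ → ℝ → ℝ → ℝ → Fin 9 → ℝ) : Prop where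
  ξ_deriv : ∀ x, 0 < x → HasDerivAt C.ξ (C.ξ₁ x) x
  ξ₁_deriv : ∀ x, 0 < x → HasDerivAt C.ξ₁ (C.ξ₂ x) x
  τ_deriv : ∀ t, HasDerivAt C.τ (C.τ₁ t) t
  φ_deriv : ∀ x, 0 < x → HasDerivAt C.φ (C.φ₁ x) x
  φ₁_deriv : ∀ x, 0 < x → HasDerivAt C.φ₁ (C.φ₂ x) x
  ψ_deriv : ∀ x, 0 < x → HasDerivAt C.ψ (C.ψ₁ x) x
  ψ₁_deriv : ∀ x, 0 < x → HasDerivAt C.ψ₁ (C.ψ₂ x) x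
  coeff_x : ∀ x t u f, 0 < x → Z x t u f 0 = C.ξ x
  coeff_t : ∀ x t u f, 0 < x → Z x t u f 1 = C.τ t
  coeff_u : ∀ x t u f, 0 < x → Z x t u f 2 = C.φ x * u + C.ψ x
  coeff_param : ∀ x t u f, 0 < x → ∀ i : Fin 5, Z x t u f (Fin.natAdd 3 i.castSucc) = C.e i

/-- The drift `α + β x - √2 lam x^δ`. -/
noncomputable def drift (θ : Fin 5 → ℝ) (x : ℝ) : ℝ :=
  θ 0 + θ 1 * x - √2 * θ 4 * x ^ θ 3

/-- The determining equations on the fibre over `θ`. -/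
structure FiberCoeffs.Solves (C : FiberCoeffs) (θ : Fin 5 → ℝ)
    (Z : ℝ → ℝ → ℝ → ℝ → Fin 9 → ℝ) : Prop extends C.Represents Z where
  det_uxx : ∀ x t, 0 < x →
    C.τ₁ t - 2 * C.ξ₁ x + 2 * θ 2 * (C.ξ x / x) + 2 * C.e 2 * Real.log x = 0
  det_ux : ∀ x t, 0 < x →
    (C.τ₁ t - C.ξ₁ x) * drift θ x + x ^ (2 * θ 2) * (2 * C.φ₁ x - C.ξ₂ x)
      + (C.e 0 + C.e 1 * x + θ 1 * C.ξ x - √2 * x ^ θ 3 * (C.e 4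
        + θ 4 * (θ 3 * (C.ξ x / x) + C.e 3 * Real.log x))) = 0
  coeff_f : ∀ x t u f, 0 < x → Z x t u f 8 = (C.φ x - C.τ₁ t) * f
    + (x ^ (2 * θ 2) * C.φ₂ x + drift θ x * C.φ₁ x) * u
    + (x ^ (2 * θ 2) * C.ψ₂ x + drift θ x * C.ψ₁ x)

/-- The operator satisfies the determining equations on the fibre over `θ`. -/
def IsFiberSolution (θ : Fin 5 → ℝ) (Z : ℝ → ℝ → ℝ → ℝ → Fin 9 → ℝ) : Prop :=
  ∃ C : FiberCoeffs, C.Solves θ Z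

/-- In normal form the coefficients of `∂_x` and `∂_t` depend on one variable each, so `D_x τ = D_t
ξ = 0` and the mixed derivative of `u` drops out. The coefficient of `∂_f` stays unevaluated, which
lets both directions of the equivalence use the formula. -/
theorem prolongedAction_of_represents {Ω : Set (Fin 5 → ℝ)} {X : (Fin 9 → ℝ) → (Fin 9 → ℝ)}
    (hX : ContDiffOn ℝ ∞ X (extDomain Ω)) {a : Fin 6 → (Fin 3 → ℝ) → ℝ} {u : (Fin 2 → ℝ) → ℝ}
    (ha : IsAdmissible Ω a) (hu : ContDiffOn ℝ ∞ u (posX 2)) {θ : Fin 5 → ℝ}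
    (hθ : ∀ q ∈ posX 3, ∀ i : Fin 5, a i.castSucc q = θ i) {C : FiberCoeffs}
    (hC : C.Represents fun x t u f => X (fiberPt θ x t u f)) {p : Fin 2 → ℝ} (hp : p ∈ posX 2) :
    prolongedAction X u a p = (C.φ (p 0) - C.τ₁ (p 1)) * pd 1 u p
      + p 0 ^ (2 * θ 2) * (C.φ₂ (p 0) * u p + 2 * C.φ₁ (p 0) * pd 0 u p
        + C.φ (p 0) * pd 0 (pd 0 u) p + C.ψ₂ (p 0) - pd 0 u p * C.ξ₂ (p 0)
        - 2 * pd 0 (pd 0 u) p * C.ξ₁ (p 0))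
      + drift θ (p 0) * (C.φ₁ (p 0) * u p + C.φ (p 0) * pd 0 u p + C.ψ₁ (p 0)
        - pd 0 u p * C.ξ₁ (p 0))
      + p 0 ^ (2 * θ 2) * (2 * θ 2 * (C.ξ (p 0) / p 0) + 2 * C.e 2 * Real.log (p 0))
        * pd 0 (pd 0 u) p
      + (C.e 0 + C.e 1 * p 0 + θ 1 * C.ξ (p 0) - √2 * p 0 ^ θ 3 * (C.e 4
        + θ 4 * (θ 3 * (C.ξ (p 0) / p 0) + C.e 3 * Real.log (p 0)))) * pd 0 u p
      - X (sectionOf u a p) 8 := by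
  have hs : ∀ q ∈ posX 2, sectionOf u a q =
      fiberPt θ (q 0) (q 1) (u q) (a 5 ![q 0, q 1, u q]) := fun q hq =>
    graphOf_eq_fiberPt (fun i => hθ ![q 0, q 1, u q] hq i)
  have g0 : ∀ q ∈ posX 2, alongSection X u a 0 q = C.ξ (q 0) := fun q hq => by
    rw [alongSection, hs q hq]; exact hC.coeff_x _ _ _ _ hq
  have g1 : ∀ q ∈ posX 2, alongSection X u a 1 q = C.τ (q 1) := fun q hq => by
    rw [alongSection, hs q hq]; exact hC.coeff_t _ _ _ _ hq
  have g2 : ∀ q ∈ posX 2, alongSection X u a 2 q = C.φ (q 0) * u q + C.ψ (q 0) := fun q hq => by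
    rw [alongSection, hs q hq]; exact hC.coeff_u _ _ _ _ hq
  have du {q : Fin 2 → ℝ} (hq : q ∈ posX 2) : DifferentiableAt ℝ u q :=
    differentiableAt_of_posX hu hq
  have d0 : ∀ i, ∀ q ∈ posX 2, pd i (alongSection X u a 0) q = if i = 0 then C.ξ₁ (q 0) else 0 :=
    fun i q hq => by rw [pd_congr hq g0]; exact pd_comp_coord (hC.ξ_deriv _ hq) i
  have d1 : ∀ i, ∀ q ∈ posX 2, pd i (alongSection X u a 1) q = if i = 1 then C.τ₁ (q 1) else 0 :=
    fun i q hq => by rw [pd_congr hq g1]; exact pd_comp_coord (hC.τ_deriv _) i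
  have d2 : ∀ i, ∀ q ∈ posX 2, pd i (alongSection X u a 2) q =
      C.φ (q 0) * pd i u q + u q * (if i = 0 then C.φ₁ (q 0) else 0)
        + if i = 0 then C.ψ₁ (q 0) else 0 := fun i q hq => by
    have e1 := differentiableAt_comp_coord (hC.φ_deriv _ hq)
    rw [pd_congr hq g2, pd_add (e1.fun_mul (du hq)) (differentiableAt_comp_coord (hC.ψ_deriv _ hq)),
      pd_mul e1 (du hq), pd_comp_coord (hC.φ_deriv _ hq), pd_comp_coord (hC.ψ_deriv _ hq)]
  have dd0 : pd 0 (pd 0 (alongSection X u a 0)) p = C.ξ₂ (p 0) := by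
    rw [pd_congr hp (d0 0)]
    simpa using pd_comp_coord (hC.ξ₁_deriv _ hp) 0
  have dd1 : pd 0 (pd 0 (alongSection X u a 1)) p = 0 := by
    rw [pd_congr hp (d1 0)]
    simp [pd_const]
  have dd2 : pd 0 (pd 0 (alongSection X u a 2)) p = C.φ (p 0) * pd 0 (pd 0 u) p
      + 2 * C.φ₁ (p 0) * pd 0 u p + C.φ₂ (p 0) * u p + C.ψ₂ (p 0) := by
    have e1 := differentiableAt_comp_coord (hC.φ_deriv _ hp)
    have e2 := differentiableAt_comp_coord (hC.φ₁_deriv _ hp)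
    have e3 := differentiableAt_comp_coord (hC.ψ₁_deriv _ hp)
    have e4 : DifferentiableAt ℝ (pd 0 u) p := differentiableAt_of_posX (contDiffOn_pd hu 0) hp
    rw [pd_congr hp (d2 0)]
    simp only [if_true]
    rw [pd_add ((e1.fun_mul e4).fun_add ((du hp).fun_mul e2)) e3, pd_add (e1.fun_mul e4) ((du hp).fun_mul e2),
      pd_mul e1 e4, pd_mul (du hp) e2, pd_comp_coord (hC.φ_deriv _ hp),
      pd_comp_coord (hC.φ₁_deriv _ hp), pd_comp_coord (hC.ψ₁_deriv _ hp)]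
    simp only [if_true]
    ring
  have z1 (i : Fin 2) : zeta1 X u a i p = pd i (alongSection X u a 2) p
    - pd 0 u p * pd i (alongSection X u a 0) p - pd 1 u p * pd i (alongSection X u a 1) p := rfl
  have hz := hs p hp
  have hv := hC.coeff_param (p 0) (p 1) (u p) (a 5 ![p 0, p 1, u p]) hp
  rw [← hz] at hv
  have v0 : X (sectionOf u a p) 0 = C.ξ (p 0) := g0 p hp
  have v3 : X (sectionOf u a p) 3 = C.e 0 := hv 0
  have v4 : X (sectionOf u a p) 4 = C.e 1 := hv 1
  have v5 : X (sectionOf u a p) 5 = C.e 2 := hv 2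
  have v6 : X (sectionOf u a p) 6 = C.e 3 := hv 3
  have v7 : X (sectionOf u a p) 7 = C.e 4 := hv 4
  rw [prolongedAction_eq X u a hp rfl rfl, zeta2_eq hu (contDiffOn_alongSection hX ha hu) hp,
    z1, z1, dd0, dd1, dd2, d0 0 p hp, d0 1 p hp, d1 0 p hp, d1 1 p hp, d2 0 p hp, d2 1 p hp,
    v0, v3, v4, v5, v6, v7, hz]
  simp [fiberPt, drift]
  ring

/-- Sufficiency of the determining equations. Modulo them the prolonged operator only rescales the
left-hand side of the equation, by the factor `φ - τ'`. -/
theorem isEquivalenceOperator_of_isFiberSolution {Ω : Set (Fin 5 → ℝ)}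
    {X : (Fin 9 → ℝ) → (Fin 9 → ℝ)} (hX : ContDiffOn ℝ ∞ X (extDomain Ω))
    (h : ∀ θ ∈ Ω, IsFiberSolution θ fun x t u f => X (fiberPt θ x t u f)) :
    IsEquivalenceOperator Ω X where
  smooth := hX
  equation a ha u hu p hp heq := by
    obtain ⟨θ, hθΩ, hθ⟩ := ha.exists_params
    obtain ⟨C, hC⟩ := h θ hθΩ
    have hs : sectionOf u a p = fiberPt θ (p 0) (p 1) (u p) (a 5 ![p 0, p 1, u p]) :=
      graphOf_eq_fiberPt (fun i => hθ ![p 0, p 1, u p] hp i)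
    rw [prolongedAction_of_represents hX ha hu hθ hC.toRepresents hp, hs,
      hC.coeff_f _ _ _ _ hp]
    have e1 := hC.det_uxx (p 0) (p 1) hp
    have e2 := hC.det_ux (p 0) (p 1) hp
    rw [hs] at heq
    have e3 : pd 1 u p + p 0 ^ (2 * θ 2) * pd 0 (pd 0 u) p + drift θ (p 0) * pd 0 u p
        - a 5 ![p 0, p 1, u p] = 0 := heq
    linear_combination (C.φ (p 0) - C.τ₁ (p 1)) * e3
      + p 0 ^ (2 * θ 2) * pd 0 (pd 0 u) p * e1 + pd 0 u p * e2
  param a ha i v q hq := by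
    obtain ⟨θ, hθΩ, hθ⟩ := ha.exists_params
    obtain ⟨C, hC⟩ := h θ hθΩ
    have e (q') (hq' : q' ∈ posX 3) : X (graphOf a q') (Fin.natAdd 3 i.castSucc) = C.e i := by
      rw [graphOf_eq_fiberPt (hθ q' hq')]
      exact hC.coeff_param _ _ _ _ hq' i
    rw [mu, pd_congr hq e, pd_const]
    simp [ha.param_const i _ q hq]
  source a ha q hq := by
    obtain ⟨θ, hθΩ, hθ⟩ := ha.exists_params
    obtain ⟨C, hC⟩ := h θ hθΩ
    have hg (q') (hq' : q' ∈ posX 3) := graphOf_eq_fiberPt (hθ q' hq')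
    -- In the `u_xx` equation `τ'` is the only term that can depend on `t`.
    have hτ : ∀ t, C.τ₁ t = C.τ₁ 0 := fun t => by
      linarith [hC.det_uxx 1 t one_pos, hC.det_uxx 1 0 one_pos]
    have d5 := hasDerivAt_coordLine (i := 1) (differentiableAt_of_posX (ha.smooth 5) hq)
    rw [ha.source_t q hq] at d5
    have hu1 (s : ℝ) : Function.update q 1 s ∈ posX 3 := by
      change 0 < Function.update q 1 s 0
      simpa using show 0 < q 0 from hq
    -- Since `f_t = 0`, moving `t` along the graph changes neither `x`, `u` nor `f`; each of the
    -- coefficients of `∂_x`, `∂_u`, `∂_f` then has zero derivative along this line.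
    have key (i : Fin 9) {G : ℝ → ℝ} (hG : HasDerivAt G 0 (q 1))
        (h : ∀ s, X (graphOf a (Function.update q 1 s)) i = G s) :
        pd 1 (fun q' => X (graphOf a q') i) q = 0 := by
      have hd : ContDiffOn ℝ ∞ (fun q' => X (graphOf a q') i) (posX 3) :=
        (contDiffOn_pi.1 hX i).comp (contDiffOn_graphOf ha.smooth) fun q hq => ⟨hq, ha.mem q hq⟩
      have h1 := hasDerivAt_coordLine (i := 1) (differentiableAt_of_posX hd hq)
      simp only [h] at h1
      exact h1.unique hG
    have p0 : pd 1 (fun q' => X (graphOf a q') 0) q = 0 :=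
      key 0 (hasDerivAt_const _ (C.ξ (q 0))) fun s => by
        rw [hg _ (hu1 s)]; simpa using hC.coeff_x _ _ _ _ (hu1 s)
    have p2 : pd 1 (fun q' => X (graphOf a q') 2) q = 0 :=
      key 2 (hasDerivAt_const _ (C.φ (q 0) * q 2 + C.ψ (q 0))) fun s => by
        rw [hg _ (hu1 s)]; simpa using hC.coeff_u _ _ _ _ (hu1 s)
    have p8 : pd 1 (fun q' => X (graphOf a q') 8) q = 0 := by
      refine key 8 (G := fun s => (C.φ (q 0) - C.τ₁ 0) * a 5 (Function.update q 1 s)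
        + (q 0 ^ (2 * θ 2) * C.φ₂ (q 0) + drift θ (q 0) * C.φ₁ (q 0)) * q 2
        + (q 0 ^ (2 * θ 2) * C.ψ₂ (q 0) + drift θ (q 0) * C.ψ₁ (q 0))) ?_ fun s => ?_
      · refine HasDerivAt.add_const _ (HasDerivAt.add_const _ ?_)
        simpa using d5.const_mul (C.φ (q 0) - C.τ₁ 0)
      · rw [hg _ (hu1 s)]
        simpa [hτ] using hC.coeff_f _ s _ _ (hu1 s)
    have hmu : mu X a 5 1 q = pd 1 (fun q' => X (graphOf a q') 8) q
      - ∑ w : Fin 3, pd w (a 5) q * pd 1 (fun q' => X (graphOf a q') (Fin.castAdd 6 w)) q := rfl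
    rw [hmu, p8, Fin.sum_univ_three]
    have s0 : pd 1 (fun q' => X (graphOf a q') (Fin.castAdd 6 0)) q = 0 := p0
    have s2 : pd 1 (fun q' => X (graphOf a q') (Fin.castAdd 6 2)) q = 0 := p2
    -- The derivative of `τ` need not vanish; its term disappears because it is multiplied by `f_t`.
    rw [s0, s2, ha.source_t q hq]
    ring

/-! ### Test functions -/

/-- Constant parameters `θ` together with a source term. -/
def elementsOf (θ : Fin 5 → ℝ) (F : (Fin 3 → ℝ) → ℝ) : Fin 6 → (Fin 3 → ℝ) → ℝ :=
  ![fun _ => θ 0, fun _ => θ 1, fun _ => θ 2, fun _ => θ 3, fun _ => θ 4, F]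

theorem elementsOf_castSucc (θ : Fin 5 → ℝ) (F : (Fin 3 → ℝ) → ℝ) (i : Fin 5) :
    elementsOf θ F i.castSucc = fun _ => θ i := by
  fin_cases i <;> rfl

theorem isAdmissible_elementsOf {Ω : Set (Fin 5 → ℝ)} {θ : Fin 5 → ℝ} (hθ : θ ∈ Ω)
    {F : (Fin 3 → ℝ) → ℝ} (hF : ContDiff ℝ ∞ F) (ht : ∀ q, pd 1 F q = 0) :
    IsAdmissible Ω (elementsOf θ F) where
  smooth i := by
    induction i using Fin.lastCases with
    | last => exact hF.contDiffOn
    | cast i => rw [elementsOf_castSucc]; exact contDiffOn_const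
  mem q _ := by
    convert hθ
    ext i; fin_cases i <;> rfl
  param_const i v q _ := by
    rw [elementsOf_castSucc, pd_const]
  source_t q _ := ht q

theorem graphOf_elementsOf (θ : Fin 5 → ℝ) (F : (Fin 3 → ℝ) → ℝ) (q : Fin 3 → ℝ) :
    graphOf (elementsOf θ F) q = fiberPt θ (q 0) (q 1) (q 2) (F q) :=
  graphOf_eq_fiberPt fun i => by rw [elementsOf_castSucc]

/-- A source term, quadratic in `x` and affine in `u`. -/
noncomputable def testSource (x₀ u₀ f₀ fx fxx fu : ℝ) (q : Fin 3 → ℝ) : ℝ :=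
  f₀ + fx * (q 0 - x₀) + fxx / 2 * (q 0 - x₀) ^ 2 + fu * (q 2 - u₀)

theorem contDiff_testSource (x₀ u₀ f₀ fx fxx fu : ℝ) :
    ContDiff ℝ ∞ (testSource x₀ u₀ f₀ fx fxx fu) := by
  unfold testSource
  have h (i : Fin 3) : ContDiff ℝ ∞ fun q : Fin 3 → ℝ => q i := contDiff_apply ℝ ℝ i
  have h0 := h 0
  have h2 := h 2
  fun_prop

/-- Computation of a partial derivative along a coordinate line. -/
theorem pd_eq_of_hasDerivAt {n : ℕ} {i : Fin n} {g : (Fin n → ℝ) → ℝ} {p : Fin n → ℝ}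
    (hg : DifferentiableAt ℝ g p) {G : ℝ → ℝ} {G' : ℝ} (hG : HasDerivAt G G' (p i))
    (h : ∀ᶠ s in 𝓝 (p i), g (Function.update p i s) = G s) : pd i g p = G' :=
  ((hasDerivAt_coordLine hg).congr_of_eventuallyEq (h.mono fun _ => Eq.symm)).unique hG

theorem hasDerivAt_quadratic (c₀ c₁ c₂ s₀ s : ℝ) :
    HasDerivAt (fun s => c₀ + c₁ * (s - s₀) + c₂ / 2 * (s - s₀) ^ 2) (c₁ + c₂ * (s - s₀)) s := by
  have h := (hasDerivAt_id s).sub_const s₀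
  refine (((h.const_mul c₁).const_add c₀).fun_add ((h.fun_pow 2).const_mul (c₂ / 2))).congr_deriv ?_
  norm_num
  ring

theorem pd_testSource (x₀ u₀ f₀ fx fxx fu : ℝ) (v : Fin 3) (q : Fin 3 → ℝ) :
    pd v (testSource x₀ u₀ f₀ fx fxx fu) q = ![fx + fxx * (q 0 - x₀), 0, fu] v := by
  have hd : DifferentiableAt ℝ (testSource x₀ u₀ f₀ fx fxx fu) q :=
    (contDiff_testSource x₀ u₀ f₀ fx fxx fu).differentiable (by simp) q
  fin_cases v
  · refine pd_eq_of_hasDerivAt hd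
      ((hasDerivAt_quadratic f₀ fx fxx x₀ (q 0)).add_const (fu * (q 2 - u₀))) (Eventually.of_forall ?_)
    intro s
    simp [testSource]
  · refine pd_eq_of_hasDerivAt hd (hasDerivAt_const _ (testSource x₀ u₀ f₀ fx fxx fu q))
      (Eventually.of_forall ?_)
    intro s
    simp [testSource]
  · refine pd_eq_of_hasDerivAt hd (G := fun s => testSource x₀ u₀ f₀ fx fxx fu q + fu * (s - q 2)) ?_
      (Eventually.of_forall ?_)
    · simpa using (((hasDerivAt_id (q 2)).sub_const (q 2)).const_mul fu).const_add
        (testSource x₀ u₀ f₀ fx fxx fu q)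
    · intro s
      simp [testSource]
      ring

theorem isAdmissible_testSource {Ω : Set (Fin 5 → ℝ)} {θ : Fin 5 → ℝ} (hθ : θ ∈ Ω)
    (x₀ u₀ f₀ fx fxx fu : ℝ) :
    IsAdmissible Ω (elementsOf θ (testSource x₀ u₀ f₀ fx fxx fu)) :=
  isAdmissible_elementsOf hθ (contDiff_testSource _ _ _ _ _ _) fun q => by
    rw [pd_testSource]; rfl

/-- A quadratic polynomial in `(x, t)` with prescribed derivatives at `(x₀, t₀)`. -/
noncomputable def testFunction (x₀ t₀ u₀ ux uxx ut uxt : ℝ) (p : Fin 2 → ℝ) : ℝ :=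
  u₀ + ux * (p 0 - x₀) + uxx / 2 * (p 0 - x₀) ^ 2 + (p 1 - t₀) * (ut + uxt * (p 0 - x₀))

section TestFunction

variable (x₀ t₀ u₀ ux uxx ut uxt : ℝ)

theorem contDiff_testFunction : ContDiff ℝ ∞ (testFunction x₀ t₀ u₀ ux uxx ut uxt) := by
  unfold testFunction
  have h (i : Fin 2) : ContDiff ℝ ∞ fun q : Fin 2 → ℝ => q i := contDiff_apply ℝ ℝ i
  have h0 := h 0
  have h1 := h 1
  fun_prop

theorem pd_zero_testFunction : pd 0 (testFunction x₀ t₀ u₀ ux uxx ut uxt) =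
    fun p => ux + uxx * (p 0 - x₀) + uxt * (p 1 - t₀) := by
  ext p
  refine pd_eq_of_hasDerivAt
    ((contDiff_testFunction x₀ t₀ u₀ ux uxx ut uxt).differentiable (by simp) p)
    (G := fun s => (u₀ + ux * (s - x₀) + uxx / 2 * (s - x₀) ^ 2)
      + (p 1 - t₀) * (ut + uxt * (s - x₀))) ?_ (Eventually.of_forall fun s => ?_)
  · refine (hasDerivAt_quadratic u₀ ux uxx x₀ (p 0)).add ?_
    refine (((((hasDerivAt_id (p 0)).sub_const x₀).const_mul uxt).const_add ut).const_mul
      (p 1 - t₀)).congr_deriv ?_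
    ring
  · simp [testFunction]

theorem pd_one_testFunction : pd 1 (testFunction x₀ t₀ u₀ ux uxx ut uxt) =
    fun p => ut + uxt * (p 0 - x₀) := by
  ext p
  refine pd_eq_of_hasDerivAt
    ((contDiff_testFunction x₀ t₀ u₀ ux uxx ut uxt).differentiable (by simp) p)
    (G := fun s => (u₀ + ux * (p 0 - x₀) + uxx / 2 * (p 0 - x₀) ^ 2)
      + (s - t₀) * (ut + uxt * (p 0 - x₀))) ?_ (Eventually.of_forall fun s => ?_)
  · simpa using (((hasDerivAt_id (p 1)).sub_const t₀).mul_const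
      (ut + uxt * (p 0 - x₀))).const_add (u₀ + ux * (p 0 - x₀) + uxx / 2 * (p 0 - x₀) ^ 2)
  · simp [testFunction]

theorem pd_affine (c₀ c₁ c₂ : ℝ) (i : Fin 2) (p : Fin 2 → ℝ) :
    pd i (fun q : Fin 2 → ℝ => c₀ + c₁ * (q 0 - x₀) + c₂ * (q 1 - t₀)) p = ![c₁, c₂] i := by
  have hd : DifferentiableAt ℝ
      (fun q : Fin 2 → ℝ => c₀ + c₁ * (q 0 - x₀) + c₂ * (q 1 - t₀)) p := by
    have h0 : DifferentiableAt ℝ (fun q : Fin 2 → ℝ => q 0) p := differentiableAt_apply _ _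
    have h1 : DifferentiableAt ℝ (fun q : Fin 2 → ℝ => q 1) p := differentiableAt_apply _ _
    fun_prop
  fin_cases i
  · refine pd_eq_of_hasDerivAt hd (G := fun s => c₀ + c₁ * (s - x₀) + c₂ * (p 1 - t₀)) ?_
      (Eventually.of_forall fun s => by simp)
    simpa using ((((hasDerivAt_id (p 0)).sub_const x₀).const_mul c₁).const_add c₀).add_const
      (c₂ * (p 1 - t₀))
  · refine pd_eq_of_hasDerivAt hd (G := fun s => c₀ + c₁ * (p 0 - x₀) + c₂ * (s - t₀)) ?_
      (Eventually.of_forall fun s => by simp)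
    simpa using (((hasDerivAt_id (p 1)).sub_const t₀).const_mul c₂).const_add
      (c₀ + c₁ * (p 0 - x₀))

theorem pd_pd_testFunction (i : Fin 2) (p : Fin 2 → ℝ) :
    pd i (pd 0 (testFunction x₀ t₀ u₀ ux uxx ut uxt)) p = ![uxx, uxt] i
      ∧ pd 0 (pd 1 (testFunction x₀ t₀ u₀ ux uxx ut uxt)) p = uxt := by
  rw [pd_zero_testFunction, pd_one_testFunction]
  refine ⟨pd_affine x₀ t₀ ux uxx uxt i p, ?_⟩
  simpa using pd_affine x₀ t₀ ut uxt 0 0 p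

end TestFunction

/-! ### Curves in a fibre -/

theorem hasDerivAt_fiberPt {A B U V : ℝ → ℝ} {A' B' U' V' s : ℝ} (θ : Fin 5 → ℝ)
    (hA : HasDerivAt A A' s) (hB : HasDerivAt B B' s) (hU : HasDerivAt U U' s)
    (hV : HasDerivAt V V' s) :
    HasDerivAt (fun s => fiberPt θ (A s) (B s) (U s) (V s)) (fiberPt 0 A' B' U' V') s := by
  rw [hasDerivAt_pi]
  intro i
  fin_cases i
  · exact hA
  · exact hB
  · exact hU
  · exact hasDerivAt_const s (θ 0)
  · exact hasDerivAt_const s (θ 1)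
  · exact hasDerivAt_const s (θ 2)
  · exact hasDerivAt_const s (θ 3)
  · exact hasDerivAt_const s (θ 4)
  · exact hV

theorem fiberPt_zero_eq (a b c d : ℝ) : fiberPt 0 a b c d =
    a • Pi.single 0 1 + b • Pi.single 1 1 + c • Pi.single 2 1 + d • Pi.single 8 1 := by
  ext i
  fin_cases i <;> simp [fiberPt]

theorem fderiv_fiberPt_zero (P : (Fin 9 → ℝ) → ℝ) (z : Fin 9 → ℝ) (a b c d : ℝ) :
    fderiv ℝ P z (fiberPt 0 a b c d) = a * pd 0 P z + b * pd 1 P z + c * pd 2 P z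
      + d * pd 8 P z := by
  rw [fiberPt_zero_eq]
  simp [pd]

/-- Chain rule along a curve inside a fibre. The velocity has no parameter component, so derivatives
of the coefficients with respect to `θ` never enter. -/
theorem hasDerivAt_comp_fiberPt {P : (Fin 9 → ℝ) → ℝ} {A B U V : ℝ → ℝ} {A' B' U' V' s : ℝ}
    {θ : Fin 5 → ℝ} (hP : DifferentiableAt ℝ P (fiberPt θ (A s) (B s) (U s) (V s)))
    (hA : HasDerivAt A A' s) (hB : HasDerivAt B B' s) (hU : HasDerivAt U U' s)
    (hV : HasDerivAt V V' s) :
    HasDerivAt (fun s => P (fiberPt θ (A s) (B s) (U s) (V s)))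
      (A' * pd 0 P (fiberPt θ (A s) (B s) (U s) (V s))
        + B' * pd 1 P (fiberPt θ (A s) (B s) (U s) (V s))
        + U' * pd 2 P (fiberPt θ (A s) (B s) (U s) (V s))
        + V' * pd 8 P (fiberPt θ (A s) (B s) (U s) (V s))) s := by
  rw [← fderiv_fiberPt_zero]
  exact hP.hasFDerivAt.comp_hasDerivAt s (hasDerivAt_fiberPt θ hA hB hU hV)

/-! ### Necessary conditions from the auxiliary equations. -/

section Forward

variable {Ω : Set (Fin 5 → ℝ)} {X : (Fin 9 → ℝ) → (Fin 9 → ℝ)}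

theorem contDiffOn_coeff (hX : ContDiffOn ℝ ∞ X (extDomain Ω)) (i : Fin 9) :
    ContDiffOn ℝ ∞ (fun z => X z i) (extDomain Ω) :=
  contDiffOn_pi.1 hX i

/-- The total derivative is `∂_v + f_v ∂_f`: the parameters are constant along the graph, so only
the source contributes. -/
theorem pd_graphOf (hΩ : IsOpen Ω) (hX : ContDiffOn ℝ ∞ X (extDomain Ω)) {θ : Fin 5 → ℝ}
    (hθ : θ ∈ Ω) (x₀ u₀ f₀ fx fxx fu : ℝ) (i : Fin 9) (v : Fin 3) {q : Fin 3 → ℝ}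
    (hq : q ∈ posX 3) :
    pd v (fun q' => X (graphOf (elementsOf θ (testSource x₀ u₀ f₀ fx fxx fu)) q') i) q =
      pd (Fin.castAdd 6 v) (fun z => X z i)
          (fiberPt θ (q 0) (q 1) (q 2) (testSource x₀ u₀ f₀ fx fxx fu q))
        + pd v (testSource x₀ u₀ f₀ fx fxx fu) q * pd 8 (fun z => X z i)
          (fiberPt θ (q 0) (q 1) (q 2) (testSource x₀ u₀ f₀ fx fxx fu q)) := by
  have ha := isAdmissible_testSource hθ x₀ u₀ f₀ fx fxx fu
  set F := testSource x₀ u₀ f₀ fx fxx fu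
  have hg : ContDiffOn ℝ ∞ (fun q' => X (graphOf (elementsOf θ F) q') i) (posX 3) :=
    (contDiffOn_coeff hX i).comp (contDiffOn_graphOf ha.smooth) fun q hq => ⟨hq, ha.mem q hq⟩
  have hF : DifferentiableAt ℝ F q := (contDiff_testSource _ _ _ _ _ _).differentiable (by simp) q
  have hc (j : Fin 3) : HasDerivAt (fun s => Function.update q v s j)
      (Pi.single (M := fun _ => ℝ) v 1 j) (q v) :=
    hasDerivAt_pi.1 (hasDerivAt_update q v (q v)) j
  have hP : DifferentiableAt ℝ (fun z => X z i) (fiberPt θ (Function.update q v (q v) 0)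
      (Function.update q v (q v) 1) (Function.update q v (q v) 2)
      (F (Function.update q v (q v)))) := by
    rw [Function.update_eq_self]
    exact ((contDiffOn_coeff hX i).contDiffAt
      ((isOpen_extDomain hΩ).mem_nhds (fiberPt_mem hθ hq _ _ _))).differentiableAt (by simp)
  have key := hasDerivAt_comp_fiberPt hP (hc 0) (hc 1) (hc 2) (hasDerivAt_coordLine hF)
  rw [Function.update_eq_self] at key
  rw [pd_eq_of_hasDerivAt (differentiableAt_of_posX hg hq) key
    (Eventually.of_forall fun s => by rw [graphOf_elementsOf])]
  fin_cases v <;> simp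

/-- All `E_w` vanish, so the condition reduces to `∂_v η_E + f_v ∂_f η_E = 0`. The slopes `f_x` and
`f_u` are at one's disposal, and both terms vanish separately. -/
theorem coeff_param_pd (hΩ : IsOpen Ω) (h : IsEquivalenceOperator Ω X) {θ : Fin 5 → ℝ}
    (hθ : θ ∈ Ω) {x : ℝ} (hx : 0 < x) (t u f : ℝ) (i : Fin 5) :
    ∀ j ∈ ({0, 1, 2, 8} : Set (Fin 9)),
      pd j (fun z => X z (Fin.natAdd 3 i.castSucc)) (fiberPt θ x t u f) = 0 := by
  have key (fx fu : ℝ) (v : Fin 3) :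
      pd (Fin.castAdd 6 v) (fun z => X z (Fin.natAdd 3 i.castSucc)) (fiberPt θ x t u f)
        + ![fx, 0, fu] v * pd 8 (fun z => X z (Fin.natAdd 3 i.castSucc)) (fiberPt θ x t u f)
          = 0 := by
    have ha := isAdmissible_testSource hθ x u f fx 0 fu
    have hq : ![x, t, u] ∈ posX 3 := hx
    have h1 := h.param _ ha i v _ hq
    rw [mu, pd_graphOf hΩ h.smooth hθ _ _ _ _ _ _ _ _ hq, pd_testSource,
      Finset.sum_eq_zero fun w _ => by rw [ha.param_const i w _ hq, zero_mul]] at h1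
    simpa [testSource] using h1
  -- A source with zero slopes isolates `∂_x`, `∂_t`, `∂_u`; slope `f_x = 1` then isolates `∂_f`.
  have k0 := key 0 0 0
  have k1 := key 0 0 1
  have k2 := key 0 0 2
  have k8 := key 1 0 0
  simp at k0 k1 k2 k8
  rw [k0, zero_add] at k8
  rintro j (rfl | rfl | rfl | rfl)
  exacts [k0, k1, k2, k8]

/-- As `f_t = 0`, the condition is affine in the free slopes: `∂_t η_f - f_x ∂_t ξ¹ - f_u ∂_t η =
0`. -/
theorem coeff_pd_t (hΩ : IsOpen Ω) (h : IsEquivalenceOperator Ω X) {θ : Fin 5 → ℝ}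
    (hθ : θ ∈ Ω) {x : ℝ} (hx : 0 < x) (t u f : ℝ) :
    pd 1 (fun z => X z 0) (fiberPt θ x t u f) = 0 ∧
      pd 1 (fun z => X z 2) (fiberPt θ x t u f) = 0 ∧
      pd 1 (fun z => X z 8) (fiberPt θ x t u f) = 0 := by
  have key (fx fu : ℝ) : pd 1 (fun z => X z 8) (fiberPt θ x t u f)
      - fx * pd 1 (fun z => X z 0) (fiberPt θ x t u f)
      - fu * pd 1 (fun z => X z 2) (fiberPt θ x t u f) = 0 := by
    have ha := isAdmissible_testSource hθ x u f fx 0 fu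
    have hq : ![x, t, u] ∈ posX 3 := hx
    have h1 := h.source _ ha _ hq
    have e : elementsOf θ (testSource x u f fx 0 fu) 5 = testSource x u f fx 0 fu := rfl
    simp only [mu, Fin.sum_univ_three, pd_graphOf hΩ h.smooth hθ _ _ _ _ _ _ _ _ hq, e,
      pd_testSource] at h1
    simp [testSource] at h1
    linear_combination h1
  have k0 := key 0 0
  have k1 := key 1 0
  have k2 := key 0 1
  refine ⟨?_, ?_, ?_⟩ <;> linarith

end Forward

theorem pd_comm {n : ℕ} {g : (Fin n → ℝ) → ℝ} {p : Fin n → ℝ} (hg : ContDiffAt ℝ ∞ g p)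
    (i j : Fin n) : pd i (pd j g) p = pd j (pd i g) p := by
  have hd : DifferentiableAt ℝ (fderiv ℝ g) p :=
    (hg.fderiv_right (m := ∞) (by simp)).differentiableAt (by simp)
  have key (i j : Fin n) : pd i (pd j g) p
      = fderiv ℝ (fderiv ℝ g) p (Pi.single i 1) (Pi.single j 1) := by
    rw [pd, show pd j g = fun q => fderiv ℝ g q (Pi.single j 1) from rfl,
      fderiv_clm_apply hd (differentiableAt_const _)]
    simp
  rw [key, key]
  exact (hg.isSymmSndFDerivAt (by
    simpa using WithTop.coe_le_coe.2 (le_top : (2 : ℕ∞) ≤ ⊤))).eq _ _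

/-! ### Splitting the prolonged equation in the jet variables. -/

section Forward

variable {Ω : Set (Fin 5 → ℝ)} {X : (Fin 9 → ℝ) → (Fin 9 → ℝ)}

theorem contDiffAt_coeff (hΩ : IsOpen Ω) (hX : ContDiffOn ℝ ∞ X (extDomain Ω)) {z : Fin 9 → ℝ}
    (hz : z ∈ extDomain Ω) (i : Fin 9) : ContDiffAt ℝ ∞ (fun z => X z i) z :=
  (contDiffOn_coeff hX i).contDiffAt ((isOpen_extDomain hΩ).mem_nhds hz)

theorem differentiableAt_pd_coeff (hΩ : IsOpen Ω) (hX : ContDiffOn ℝ ∞ X (extDomain Ω))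
    {z : Fin 9 → ℝ} (hz : z ∈ extDomain Ω) (i j : Fin 9) :
    DifferentiableAt ℝ (pd j fun z => X z i) z :=
  (((contDiffAt_coeff hΩ hX hz i).fderiv_right (m := ∞) (by simp)).differentiableAt
    (by simp)).clm_apply (differentiableAt_const _)

/-- The derivatives of the coefficients along the section given by the test functions. -/
theorem alongSection_test (hΩ : IsOpen Ω) (hX : ContDiffOn ℝ ∞ X (extDomain Ω)) {θ : Fin 5 → ℝ}
    (hθ : θ ∈ Ω) {x : ℝ} (hx : 0 < x) (t u f ux uxx fxx ut uxt : ℝ) (i : Fin 9)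
    {z : Fin 9 → ℝ} (hz : fiberPt θ x t u f = z) {P : (Fin 9 → ℝ) → ℝ}
    (hP : (fun z => X z i) = P) {g : (Fin 2 → ℝ) → ℝ}
    (hg : alongSection X (testFunction x t u ux uxx ut uxt)
      (elementsOf θ (testSource x u f 0 fxx 0)) i = g) :
    pd 0 g ![x, t] = pd 0 P z + ux * pd 2 P z ∧
    pd 1 g ![x, t] = pd 1 P z + ut * pd 2 P z ∧
    pd 0 (pd 0 g) ![x, t] = pd 0 (pd 0 P) z + ux * pd 2 (pd 0 P) z
      + ux * (pd 0 (pd 2 P) z + ux * pd 2 (pd 2 P) z) + uxx * pd 2 P z + fxx * pd 8 P z := by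
  set v := testFunction x t u ux uxx ut uxt with hv
  set F := testSource x u f 0 fxx 0 with hF
  have ha : IsAdmissible Ω (elementsOf θ F) := isAdmissible_testSource hθ _ _ _ _ _ _
  have hu : ContDiff ℝ ∞ v := contDiff_testFunction _ _ _ _ _ _ _
  have hgs : ContDiffOn ℝ ∞ g (posX 2) := hg ▸ contDiffOn_alongSection hX ha hu.contDiffOn i
  have hgP (q : Fin 2 → ℝ) : g q = P (fiberPt θ (q 0) (q 1) (v q)
      (f + 0 * (q 0 - x) + fxx / 2 * (q 0 - x) ^ 2)) := by
    rw [← hg, ← hP, alongSection, sectionOf, graphOf_elementsOf]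
    simp [hF, testSource]
  have hPd {q : Fin 2 → ℝ} (hq : q ∈ posX 2) (s r : ℝ) :
      DifferentiableAt ℝ P (fiberPt θ (q 0) (q 1) s r) := by
    rw [← hP]
    exact (contDiffAt_coeff hΩ hX (fiberPt_mem hθ hq _ _ _) i).differentiableAt (by simp)
  have hPd2 (j : Fin 9) {q : Fin 2 → ℝ} (hq : q ∈ posX 2) (s r : ℝ) :
      DifferentiableAt ℝ (pd j P) (fiberPt θ (q 0) (q 1) s r) := by
    rw [← hP]
    exact differentiableAt_pd_coeff hΩ hX (fiberPt_mem hθ hq _ _ _) i j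
  have hvl (j : Fin 2) (q : Fin 2 → ℝ) :=
    hasDerivAt_coordLine (i := j) (hu.differentiable (by simp) q)
  -- This first derivative is needed on the whole half space because it is differentiated once more.
  have d0 : ∀ q ∈ posX 2, pd 0 g q = pd 0 P (fiberPt θ (q 0) (q 1) (v q)
        (f + 0 * (q 0 - x) + fxx / 2 * (q 0 - x) ^ 2))
      + (ux + uxx * (q 0 - x) + uxt * (q 1 - t)) * pd 2 P (fiberPt θ (q 0) (q 1) (v q)
        (f + 0 * (q 0 - x) + fxx / 2 * (q 0 - x) ^ 2))
      + fxx * (q 0 - x) * pd 8 P (fiberPt θ (q 0) (q 1) (v q)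
        (f + 0 * (q 0 - x) + fxx / 2 * (q 0 - x) ^ 2)) := fun q hq => by
    have h := hasDerivAt_comp_fiberPt (P := P) (θ := θ) (hPd hq _ _) (hasDerivAt_id (q 0))
      (hasDerivAt_const (q 0) (q 1)) (hvl 0 q) (hasDerivAt_quadratic f 0 fxx x (q 0))
    rw [pd_eq_of_hasDerivAt (differentiableAt_of_posX hgs hq) h
      (Eventually.of_forall fun s => by rw [hgP]; simp), hv, pd_zero_testFunction]
    simp
  have hp : ![x, t] ∈ posX 2 := hx
  have hz' : fiberPt θ x t (v ![x, t]) f = z := by rw [← hz]; simp [hv, testFunction]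
  have up0 : Function.update ![x, t] 0 x = ![x, t] := Function.update_eq_self 0 ![x, t]
  have up1 : Function.update ![x, t] 1 t = ![x, t] := Function.update_eq_self 1 ![x, t]
  refine ⟨?_, ?_, ?_⟩
  · rw [d0 _ hp]
    simp [hz']
  · have h := hasDerivAt_comp_fiberPt (P := P) (θ := θ) (hPd hp _ _)
      (hasDerivAt_const t x) (hasDerivAt_id t) (hvl 1 ![x, t])
      (hasDerivAt_const t (f + 0 * (x - x) + fxx / 2 * (x - x) ^ 2))
    rw [pd_eq_of_hasDerivAt (differentiableAt_of_posX hgs hp) h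
      (Eventually.of_forall fun s => by rw [hgP]; simp), hv, pd_one_testFunction, ← hv]
    simp [up1, hz']
  -- The source has zero slope at the base point, so `∂_f P` survives only through `fxx`.
  · have hc (j : Fin 9) := hasDerivAt_comp_fiberPt (P := pd j P) (θ := θ) (hPd2 j hp _ _)
      (hasDerivAt_id x) (hasDerivAt_const x t) (hvl 0 ![x, t]) (hasDerivAt_quadratic f 0 fxx x x)
    have hl (c : ℝ) := ((hasDerivAt_id x).sub_const x).const_mul c
    have h := ((hc 0).fun_add (((hl uxx).const_add ux).fun_mul (hc 2))).fun_add
      ((hl fxx).fun_mul (hc 8))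
    rw [pd_eq_of_hasDerivAt (differentiableAt_of_posX (contDiffOn_pd hgs 0) hp) h, hv,
      pd_zero_testFunction, ← hv]
    · simp [up0, hz']
      ring
    · filter_upwards [Ioi_mem_nhds hx] with s hs
      rw [d0 _ (show Function.update ![x, t] 0 s ∈ posX 2 by simpa [posX] using hs)]
      simp

/-- The prolonged equation, evaluated on test functions, as a polynomial in the jet. -/
theorem test_equation (hΩ : IsOpen Ω) (h : IsEquivalenceOperator Ω X) {θ : Fin 5 → ℝ}
    (hθ : θ ∈ Ω) {x : ℝ} (hx : 0 < x) (t u f : ℝ) {z : Fin 9 → ℝ} (hz : fiberPt θ x t u f = z)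
    {ξ τ η : (Fin 9 → ℝ) → ℝ} (hξ : (fun z => X z 0) = ξ) (hτ : (fun z => X z 1) = τ)
    (hη : (fun z => X z 2) = η) : ∃ m₁ m₂ : ℝ, ∀ ux uxx fxx uxt w : ℝ,
      w = f - drift θ x * ux - x ^ (2 * θ 2) * uxx →
      (pd 1 η z + w * pd 2 η z - ux * (pd 1 ξ z + w * pd 2 ξ z)
        - w * (pd 1 τ z + w * pd 2 τ z))
      + x ^ (2 * θ 2) * (
        (pd 0 (pd 0 η) z + ux * pd 2 (pd 0 η) z + ux * (pd 0 (pd 2 η) z + ux * pd 2 (pd 2 η) z)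
          + uxx * pd 2 η z + fxx * pd 8 η z)
        - ux * (pd 0 (pd 0 ξ) z + ux * pd 2 (pd 0 ξ) z
          + ux * (pd 0 (pd 2 ξ) z + ux * pd 2 (pd 2 ξ) z) + uxx * pd 2 ξ z + fxx * pd 8 ξ z)
        - w * (pd 0 (pd 0 τ) z + ux * pd 2 (pd 0 τ) z
          + ux * (pd 0 (pd 2 τ) z + ux * pd 2 (pd 2 τ) z) + uxx * pd 2 τ z + fxx * pd 8 τ z)
        - 2 * uxx * (pd 0 ξ z + ux * pd 2 ξ z) - 2 * uxt * (pd 0 τ z + ux * pd 2 τ z))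
      + drift θ x * (pd 0 η z + ux * pd 2 η z - ux * (pd 0 ξ z + ux * pd 2 ξ z)
        - w * (pd 0 τ z + ux * pd 2 τ z))
      + m₁ * uxx + m₂ * ux - X z 8 = 0 := by
  -- These are the variations of the diffusion coefficient `x^(2γ)` and of the drift. For the
  -- splitting only their independence of the jet matters.
  refine ⟨z 0 ^ (2 * z 5) * (2 * z 5 * (X z 0 / z 0) + 2 * X z 5 * Real.log (z 0)),
    X z 3 + X z 4 * z 0 + z 4 * X z 0 - √2 * z 0 ^ z 6 * (X z 7
        + z 7 * (z 6 * (X z 0 / z 0) + X z 6 * Real.log (z 0))), fun ux uxx fxx uxt w hw => ?_⟩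
  have ha := isAdmissible_testSource hθ x u f 0 fxx 0
  have hu : ContDiffOn ℝ ∞ (testFunction x t u ux uxx w uxt) (posX 2) :=
    (contDiff_testFunction _ _ _ _ _ _ _).contDiffOn
  have hp : ![x, t] ∈ posX 2 := hx
  have hs : sectionOf (testFunction x t u ux uxx w uxt)
      (elementsOf θ (testSource x u f 0 fxx 0)) ![x, t] = z := by
    rw [sectionOf, graphOf_elementsOf, ← hz]
    simp [testFunction, testSource]
  have b0 : pd 0 (testFunction x t u ux uxx w uxt) ![x, t] = ux := by
    rw [pd_zero_testFunction]; simp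
  have b1 : pd 1 (testFunction x t u ux uxx w uxt) ![x, t] = w := by
    rw [pd_one_testFunction]; simp
  have b00 : pd 0 (pd 0 (testFunction x t u ux uxx w uxt)) ![x, t] = uxx :=
    (pd_pd_testFunction x t u ux uxx w uxt 0 _).1
  have b10 : pd 1 (pd 0 (testFunction x t u ux uxx w uxt)) ![x, t] = uxt :=
    (pd_pd_testFunction x t u ux uxx w uxt 1 _).1
  have b01 := (pd_pd_testFunction x t u ux uxx w uxt 0 ![x, t]).2
  obtain ⟨x0, x1, x00⟩ := alongSection_test hΩ h.smooth hθ hx t u f ux uxx fxx w uxt 0 hz hξ rfl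
  obtain ⟨t0, t1, t00⟩ := alongSection_test hΩ h.smooth hθ hx t u f ux uxx fxx w uxt 1 hz hτ rfl
  obtain ⟨e0, e1, e00⟩ := alongSection_test hΩ h.smooth hθ hx t u f ux uxx fxx w uxt 2 hz hη rfl
  have z1 (i : Fin 2) : zeta1 X (testFunction x t u ux uxx w uxt)
      (elementsOf θ (testSource x u f 0 fxx 0)) i ![x, t] =
      pd i (alongSection X (testFunction x t u ux uxx w uxt)
        (elementsOf θ (testSource x u f 0 fxx 0)) 2) ![x, t]
      - pd 0 (testFunction x t u ux uxx w uxt) ![x, t] * pd i (alongSection X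
        (testFunction x t u ux uxx w uxt) (elementsOf θ (testSource x u f 0 fxx 0)) 0) ![x, t]
      - pd 1 (testFunction x t u ux uxx w uxt) ![x, t] * pd i (alongSection X
        (testFunction x t u ux uxx w uxt) (elementsOf θ (testSource x u f 0 fxx 0)) 1) ![x, t] :=
    rfl
  have heq : equationLHS z ux w uxx = 0 := by
    rw [← hz, equationLHS, hw]
    simp [fiberPt, drift]
  have key := h.equation _ ha _ hu _ hp (by rw [hs, b0, b1, b00]; exact heq)
  rw [prolongedAction_eq X _ _ hp hs rfl, zeta2_eq hu (contDiffOn_alongSection h.smooth ha hu) hp,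
    z1, z1, b0, b1, b00, b10, b01, x0, x1, x00, t0, t1, t00, e0, e1, e00] at key
  have k5 : z 0 ^ (2 * z 5) = x ^ (2 * θ 2) := by rw [← hz]; simp [fiberPt]
  have kb : z 3 + z 4 * z 0 - √2 * z 7 * z 0 ^ z 6 = drift θ x := by
    rw [← hz]; simp [fiberPt, drift]
  rw [kb] at key
  rw [← k5]
  linear_combination key

/-- The coefficient of `∂_t` depends on `t` only, those of `∂_x` and `∂_u` do not depend on `f`. -/
theorem first_order_conditions (hΩ : IsOpen Ω) (h : IsEquivalenceOperator Ω X) {z : Fin 9 → ℝ}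
    (hz : z ∈ extDomain Ω) : pd 0 (fun z => X z 1) z = 0 ∧ pd 2 (fun z => X z 1) z = 0 ∧
      pd 8 (fun z => X z 1) z = 0 ∧ pd 8 (fun z => X z 0) z = 0 ∧
      pd 8 (fun z => X z 2) z = 0 := by
  obtain ⟨m₁, m₂, e⟩ := test_equation hΩ h hz.2 hz.1 (z 1) (z 2) (z 8) (fiberPt_params z) rfl rfl rfl
  have hP : z 0 ^ (2 * params z 2) ≠ 0 := (Real.rpow_pos_of_pos hz.1 _).ne'
  generalize z 0 ^ (2 * params z 2) = P at e hP
  -- The variable `u_xt` occurs only in `-2 x^(2γ) u_xt D_x τ`. Differencing in it at `u_x = 0` and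
  -- at `u_x = 1` kills `τ_x` and `τ_u`.
  have t0 : pd 0 (fun z => X z 1) z = 0 := mul_left_cancel₀ hP (by
    linear_combination (e 0 0 0 0 _ rfl - e 0 0 0 1 _ rfl) / 2)
  have t2 : pd 2 (fun z => X z 1) z = 0 := mul_left_cancel₀ hP (by
    linear_combination (e 1 0 0 0 _ rfl - e 1 0 0 1 _ rfl) / 2 - P * t0)
  -- Mixed second difference in `u_xx` and `fxx`: eliminating `u_t` turns the term `-u_t fxx τ_f`
  -- into one containing `u_xx fxx`, with total coefficient `x^(4γ) τ_f`.
  have t8 : pd 8 (fun z => X z 1) z = 0 := mul_left_cancel₀ (mul_ne_zero hP hP) (by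
    linear_combination (e 0 1 1 0 _ rfl - e 0 1 0 0 _ rfl) - (e 0 0 1 0 _ rfl - e 0 0 0 0 _ rfl))
  -- Differencing in `fxx` at `u_x = 0`, and below at `u_x = 1`, separates `η_f` from `ξ_f`, where
  -- the index denotes the derivative in `f`.
  have u8 : pd 8 (fun z => X z 2) z = 0 := mul_left_cancel₀ hP (by
    linear_combination (e 0 0 1 0 _ rfl - e 0 0 0 0 _ rfl) + P * z 8 * t8)
  have x8 : pd 8 (fun z => X z 0) z = 0 := mul_left_cancel₀ hP (by
    linear_combination (e 1 0 0 0 _ rfl - e 1 0 1 0 _ rfl) + P * u8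
      - P * (z 8 - drift (params z) (z 0)) * t8)
  exact ⟨t0, t2, t8, x8, u8⟩

theorem pd_pd_eq_zero (hΩ : IsOpen Ω) {P : (Fin 9 → ℝ) → ℝ} {j : Fin 9}
    (hP : ∀ z ∈ extDomain Ω, pd j P z = 0) (k : Fin 9) {z : Fin 9 → ℝ} (hz : z ∈ extDomain Ω) :
    pd k (pd j P) z = 0 := by
  rw [pd_congr_of_eventuallyEq (h := fun _ => 0)
    (eventually_of_mem ((isOpen_extDomain hΩ).mem_nhds hz) hP), pd_const]

/-- The coefficient of `∂_x` does not depend on `u`, the coefficient of `∂_u` is affine in `u`. -/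
theorem second_order_conditions (hΩ : IsOpen Ω) (h : IsEquivalenceOperator Ω X) {z : Fin 9 → ℝ}
    (hz : z ∈ extDomain Ω) : pd 2 (fun z => X z 0) z = 0 ∧ pd 2 (pd 2 fun z => X z 2) z = 0 := by
  have ht0 (k : Fin 9) {z} (hz : z ∈ extDomain Ω) := pd_pd_eq_zero hΩ
    (fun z hz => (first_order_conditions hΩ h hz).1) k hz
  have ht2 (k : Fin 9) {z} (hz : z ∈ extDomain Ω) := pd_pd_eq_zero hΩ
    (fun z hz => (first_order_conditions hΩ h hz).2.1) k hz
  have hx2 : ∀ z ∈ extDomain Ω, pd 2 (fun z => X z 0) z = 0 := fun z hz => by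
    obtain ⟨m₁, m₂, e⟩ :=
      test_equation hΩ h hz.2 hz.1 (z 1) (z 2) (z 8) (fiberPt_params z) rfl rfl rfl
    obtain ⟨t0, t2, t8, x8, u8⟩ := first_order_conditions hΩ h hz
    have hP : z 0 ^ (2 * params z 2) ≠ 0 := (Real.rpow_pos_of_pos hz.1 _).ne'
    generalize z 0 ^ (2 * params z 2) = P at e hP
    simp only [t0, t2, t8, x8, u8, ht0 _ hz, ht2 _ hz] at e
    -- Mixed second difference in `u_x` and `u_xx`; the coefficient of `u_x u_xx` is now `-2 x^(2γ)
    -- ξ_u`.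
    exact mul_left_cancel₀ hP (by
      linear_combination (e 1 0 0 0 _ rfl + e 0 1 0 0 _ rfl - e 1 1 0 0 _ rfl
        - e 0 0 0 0 _ rfl) / 2)
  refine ⟨hx2 z hz, ?_⟩
  obtain ⟨m₁, m₂, e⟩ :=
    test_equation hΩ h hz.2 hz.1 (z 1) (z 2) (z 8) (fiberPt_params z) rfl rfl rfl
  obtain ⟨t0, t2, t8, x8, u8⟩ := first_order_conditions hΩ h hz
  have hP : z 0 ^ (2 * params z 2) ≠ 0 := (Real.rpow_pos_of_pos hz.1 _).ne'
  generalize z 0 ^ (2 * params z 2) = P at e hP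
  have x1 : pd 1 (fun z => X z 0) z = 0 := by
    rw [← fiberPt_params z]
    exact (coeff_pd_t hΩ h hz.2 hz.1 _ _ _).1
  have x20 : pd 2 (pd 0 fun z => X z 0) z = 0 := by
    rw [pd_comm (contDiffAt_coeff hΩ h.smooth hz 0), pd_pd_eq_zero hΩ hx2 _ hz]
  simp only [t0, t2, t8, x8, u8, x1, x20, hx2 z hz, ht0 _ hz, ht2 _ hz,
    pd_pd_eq_zero hΩ hx2 _ hz] at e
  -- Central second difference in `u_x`; once `ξ_u` and its derivatives are gone, the coefficient of
  -- `u_x²` is `x^(2γ) η_uu`.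
  exact mul_left_cancel₀ hP (by
    linear_combination (e 1 0 0 0 _ rfl + e (-1) 0 0 0 _ rfl - 2 * e 0 0 0 0 _ rfl) / 2)

end Forward

/-! ### Normal form of the coefficients on a fibre. -/

theorem contDiff_fiberPt_x (θ : Fin 5 → ℝ) (t u f : ℝ) :
    ContDiff ℝ ∞ fun x => fiberPt θ x t u f := by
  rw [contDiff_pi]
  intro i
  fin_cases i <;> first | exact contDiff_id | exact contDiff_const

theorem contDiff_fiberPt_t (θ : Fin 5 → ℝ) (x u f : ℝ) :
    ContDiff ℝ ∞ fun t => fiberPt θ x t u f := by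
  rw [contDiff_pi]
  intro i
  fin_cases i <;> first | exact contDiff_id | exact contDiff_const

section Forward

variable {Ω : Set (Fin 5 → ℝ)} {X : (Fin 9 → ℝ) → (Fin 9 → ℝ)}

theorem contDiffOn_coeff_x (hX : ContDiffOn ℝ ∞ X (extDomain Ω)) {θ : Fin 5 → ℝ} (hθ : θ ∈ Ω)
    (t u f : ℝ) (i : Fin 9) :
    ContDiffOn ℝ ∞ (fun x => X (fiberPt θ x t u f) i) (Set.Ioi 0) :=
  (contDiffOn_coeff hX i).comp (contDiff_fiberPt_x θ t u f).contDiffOn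
    fun _ hx => fiberPt_mem hθ hx _ _ _

theorem contDiff_coeff_t (hX : ContDiffOn ℝ ∞ X (extDomain Ω)) {θ : Fin 5 → ℝ} (hθ : θ ∈ Ω)
    {x : ℝ} (hx : 0 < x) (u f : ℝ) (i : Fin 9) :
    ContDiff ℝ ∞ (fun t => X (fiberPt θ x t u f) i) := by
  rw [← contDiffOn_univ]
  exact (contDiffOn_coeff hX i).comp (contDiff_fiberPt_t θ x u f).contDiffOn
    fun _ _ => fiberPt_mem hθ hx _ _ _

theorem hasDerivAt_coeff_u {θ : Fin 5 → ℝ} (x t u f : ℝ) {P : (Fin 9 → ℝ) → ℝ}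
    (hP : DifferentiableAt ℝ P (fiberPt θ x t u f)) :
    HasDerivAt (fun u => P (fiberPt θ x t u f)) (pd 2 P (fiberPt θ x t u f)) u := by
  simpa using hasDerivAt_comp_fiberPt (A := fun _ => x) (B := fun _ => t) (U := fun u => u)
    (V := fun _ => f) hP (hasDerivAt_const u x) (hasDerivAt_const u t) (hasDerivAt_id u)
    (hasDerivAt_const u f)

/-- Only the half line has to be connected, not `Ω`. The base points are `1` for `x` and, in the
companion lemmas, `0` for `t`, `u` and `f`. -/
theorem coeff_indep_x (hΩ : IsOpen Ω) (hX : ContDiffOn ℝ ∞ X (extDomain Ω)) {θ : Fin 5 → ℝ}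
    (hθ : θ ∈ Ω) {i : Fin 9}
    (h : ∀ x t u f, 0 < x → pd 0 (fun z => X z i) (fiberPt θ x t u f) = 0)
    {x : ℝ} (hx : 0 < x) (t u f : ℝ) :
    X (fiberPt θ x t u f) i = X (fiberPt θ 1 t u f) i := by
  have hd (x) (hx : 0 < x) := (contDiffAt_coeff hΩ hX (fiberPt_mem hθ hx t u f)
    i).differentiableAt (by simp)
  have hd' (x) (hx : 0 < x) : HasDerivAt (fun x => X (fiberPt θ x t u f) i) 0 x := by
    simpa [h _ _ _ _ hx] using hasDerivAt_comp_fiberPt (A := fun x => x) (B := fun _ => t)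
      (U := fun _ => u) (V := fun _ => f) (hd x hx) (hasDerivAt_id x) (hasDerivAt_const x t)
      (hasDerivAt_const x u) (hasDerivAt_const x f)
  exact isOpen_Ioi.is_const_of_deriv_eq_zero isPreconnected_Ioi
    (fun x hx => (hd' x hx).differentiableAt.differentiableWithinAt)
    (fun x hx => (hd' x hx).deriv) hx (Set.mem_Ioi.2 one_pos)

theorem coeff_indep_t (hΩ : IsOpen Ω) (hX : ContDiffOn ℝ ∞ X (extDomain Ω)) {θ : Fin 5 → ℝ}
    (hθ : θ ∈ Ω) {i : Fin 9}
    (h : ∀ x t u f, 0 < x → pd 1 (fun z => X z i) (fiberPt θ x t u f) = 0)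
    {x : ℝ} (hx : 0 < x) (t u f : ℝ) :
    X (fiberPt θ x t u f) i = X (fiberPt θ x 0 u f) i := by
  have hd (t) := (contDiffAt_coeff hΩ hX (fiberPt_mem hθ hx t u f) i).differentiableAt (by simp)
  have hd' (t) : HasDerivAt (fun t => X (fiberPt θ x t u f) i) 0 t := by
    simpa [h _ _ _ _ hx] using hasDerivAt_comp_fiberPt (A := fun _ => x) (B := fun t => t)
      (U := fun _ => u) (V := fun _ => f) (hd t) (hasDerivAt_const t x) (hasDerivAt_id t)
      (hasDerivAt_const t u) (hasDerivAt_const t f)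
  exact is_const_of_deriv_eq_zero (fun t => (hd' t).differentiableAt) (fun t => (hd' t).deriv) t 0

theorem coeff_indep_u (hΩ : IsOpen Ω) (hX : ContDiffOn ℝ ∞ X (extDomain Ω)) {θ : Fin 5 → ℝ}
    (hθ : θ ∈ Ω) {i : Fin 9}
    (h : ∀ x t u f, 0 < x → pd 2 (fun z => X z i) (fiberPt θ x t u f) = 0)
    {x : ℝ} (hx : 0 < x) (t u f : ℝ) :
    X (fiberPt θ x t u f) i = X (fiberPt θ x t 0 f) i := by
  have hd (u) := (contDiffAt_coeff hΩ hX (fiberPt_mem hθ hx t u f) i).differentiableAt (by simp)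
  have hd' (u) : HasDerivAt (fun u => X (fiberPt θ x t u f) i) 0 u := by
    simpa [h _ _ _ _ hx] using hasDerivAt_coeff_u x t u f (hd u)
  exact is_const_of_deriv_eq_zero (fun t => (hd' t).differentiableAt) (fun t => (hd' t).deriv) u 0

theorem coeff_indep_f (hΩ : IsOpen Ω) (hX : ContDiffOn ℝ ∞ X (extDomain Ω)) {θ : Fin 5 → ℝ}
    (hθ : θ ∈ Ω) {i : Fin 9}
    (h : ∀ x t u f, 0 < x → pd 8 (fun z => X z i) (fiberPt θ x t u f) = 0)
    {x : ℝ} (hx : 0 < x) (t u f : ℝ) :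
    X (fiberPt θ x t u f) i = X (fiberPt θ x t u 0) i := by
  have hd (f) := (contDiffAt_coeff hΩ hX (fiberPt_mem hθ hx t u f) i).differentiableAt (by simp)
  have hd' (f) : HasDerivAt (fun f => X (fiberPt θ x t u f) i) 0 f := by
    simpa [h _ _ _ _ hx] using hasDerivAt_comp_fiberPt (A := fun _ => x) (B := fun _ => t)
      (U := fun _ => u) (V := fun f => f) (hd f) (hasDerivAt_const f x) (hasDerivAt_const f t)
      (hasDerivAt_const f u) (hasDerivAt_id f)
  exact is_const_of_deriv_eq_zero (fun t => (hd' t).differentiableAt) (fun t => (hd' t).deriv) f 0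

/-- The slope is written as a difference of two values of the coefficient, so that its smoothness in
`x` is inherited directly. -/
theorem coeff_affine_u (hΩ : IsOpen Ω) (hX : ContDiffOn ℝ ∞ X (extDomain Ω)) {θ : Fin 5 → ℝ}
    (hθ : θ ∈ Ω) {i : Fin 9}
    (h : ∀ x t u f, 0 < x → pd 2 (pd 2 fun z => X z i) (fiberPt θ x t u f) = 0)
    {x : ℝ} (hx : 0 < x) (t u f : ℝ) :
    X (fiberPt θ x t u f) i = (X (fiberPt θ x t 1 f) i - X (fiberPt θ x t 0 f) i) * u
      + X (fiberPt θ x t 0 f) i := by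
  have hd (u) := hasDerivAt_coeff_u x t u f
    ((contDiffAt_coeff hΩ hX (fiberPt_mem hθ hx t u f) i).differentiableAt (by simp))
  have hd' (u) := hasDerivAt_coeff_u x t u f
    (differentiableAt_pd_coeff hΩ hX (fiberPt_mem hθ hx t u f) i 2)
  have hc (u) : pd 2 (fun z => X z i) (fiberPt θ x t u f)
      = pd 2 (fun z => X z i) (fiberPt θ x t 0 f) :=
    is_const_of_deriv_eq_zero (fun u => (hd' u).differentiableAt)
      (fun u => by rw [(hd' u).deriv, h _ _ _ _ hx]) u 0
  have key (u : ℝ) : X (fiberPt θ x t u f) i - pd 2 (fun z => X z i) (fiberPt θ x t 0 f) * u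
      = X (fiberPt θ x t 0 f) i := by
    have hl (u : ℝ) := (hd u).fun_sub ((hasDerivAt_id u).const_mul
      (pd 2 (fun z => X z i) (fiberPt θ x t 0 f)))
    simpa using is_const_of_deriv_eq_zero (fun u => (hl u).differentiableAt)
      (fun u => by rw [(hl u).deriv, hc u]; ring) u 0
  linear_combination key u - u * key 1

theorem hasDerivAt_deriv_Ioi {g : ℝ → ℝ} (hg : ContDiffOn ℝ ∞ g (Set.Ioi 0)) {x : ℝ}
    (hx : 0 < x) :
    HasDerivAt g (deriv g x) x ∧ HasDerivAt (deriv g) (deriv (deriv g) x) x := by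
  have h1 : ContDiffOn ℝ ∞ (deriv g) (Set.Ioi 0) := hg.deriv_of_isOpen isOpen_Ioi (by simp)
  have hd {g : ℝ → ℝ} (hg : ContDiffOn ℝ ∞ g (Set.Ioi 0)) : DifferentiableAt ℝ g x :=
    (hg.contDiffAt (Ioi_mem_nhds hx)).differentiableAt (by simp)
  exact ⟨(hd hg).hasDerivAt, (hd h1).hasDerivAt⟩

theorem IsEquivalenceOperator.exists_represents (hΩ : IsOpen Ω) (h : IsEquivalenceOperator Ω X)
    {θ : Fin 5 → ℝ} (hθ : θ ∈ Ω) :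
    ∃ C : FiberCoeffs, C.Represents fun x t u f => X (fiberPt θ x t u f) := by
  have hX := h.smooth
  have fo {x : ℝ} (hx : 0 < x) (t u f : ℝ) :=
    first_order_conditions hΩ h (fiberPt_mem hθ hx t u f)
  have so {x : ℝ} (hx : 0 < x) (t u f : ℝ) :=
    second_order_conditions hΩ h (fiberPt_mem hθ hx t u f)
  have hψ := contDiffOn_coeff_x hX hθ 0 0 0 2
  have hφ := (contDiffOn_coeff_x hX hθ 0 1 0 2).sub hψ
  have hξ := contDiffOn_coeff_x hX hθ 0 0 0 0
  have hτ := (contDiff_coeff_t hX hθ one_pos 0 0 1).differentiable (by simp)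
  -- The functions are read off along lines through base points: `ξ`, `φ`, `ψ` at `t = 0`, `f = 0`,
  -- and `τ` at `x = 1`.
  refine ⟨⟨_, _, _, _, _, _, _, _, _, _, _,
      fun i => X (fiberPt θ 1 0 0 0) (Fin.natAdd 3 i.castSucc)⟩,
    fun x hx => (hasDerivAt_deriv_Ioi hξ hx).1, fun x hx => (hasDerivAt_deriv_Ioi hξ hx).2,
    fun t => (hτ t).hasDerivAt,
    fun x hx => (hasDerivAt_deriv_Ioi hφ hx).1, fun x hx => (hasDerivAt_deriv_Ioi hφ hx).2,
    fun x hx => (hasDerivAt_deriv_Ioi hψ hx).1, fun x hx => (hasDerivAt_deriv_Ioi hψ hx).2,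
    fun x t u f hx => ?_, fun x t u f hx => ?_, fun x t u f hx => ?_, fun x t u f hx i => ?_⟩
  · rw [coeff_indep_t hΩ hX hθ (fun x t u f hx => (coeff_pd_t hΩ h hθ hx t u f).1) hx,
      coeff_indep_u hΩ hX hθ (fun x t u f hx => (so hx t u f).1) hx,
      coeff_indep_f hΩ hX hθ (fun x t u f hx => (fo hx t u f).2.2.2.1) hx]
  · rw [coeff_indep_x hΩ hX hθ (fun x t u f hx => (fo hx t u f).1) hx,
      coeff_indep_u hΩ hX hθ (fun x t u f hx => (fo hx t u f).2.1) one_pos,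
      coeff_indep_f hΩ hX hθ (fun x t u f hx => (fo hx t u f).2.2.1) one_pos]
  · rw [coeff_indep_t hΩ hX hθ (fun x t u f hx => (coeff_pd_t hΩ h hθ hx t u f).2.1) hx,
      coeff_indep_f hΩ hX hθ (fun x t u f hx => (fo hx t u f).2.2.2.2) hx,
      coeff_affine_u hΩ hX hθ (fun x t u f hx => (so hx t u f).2) hx]
  · have k {x : ℝ} (hx : 0 < x) (t u f : ℝ) := coeff_param_pd hΩ h hθ hx t u f i
    rw [coeff_indep_t hΩ hX hθ (fun x t u f hx => k hx t u f 1 (by simp)) hx,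
      coeff_indep_u hΩ hX hθ (fun x t u f hx => k hx t u f 2 (by simp)) hx,
      coeff_indep_f hΩ hX hθ (fun x t u f hx => k hx t u f 8 (by simp)) hx,
      coeff_indep_x hΩ hX hθ (fun x t u f hx => k hx t u f 0 (by simp)) hx]

/-- With the normal form available and `u_t` eliminated, the condition is affine in the free `u_x`
and `u_xx`. Its three coefficients are the three determining equations. -/
theorem IsEquivalenceOperator.isFiberSolution (hΩ : IsOpen Ω) (h : IsEquivalenceOperator Ω X)
    {θ : Fin 5 → ℝ} (hθ : θ ∈ Ω) : IsFiberSolution θ fun x t u f => X (fiberPt θ x t u f) := by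
  obtain ⟨C, hC⟩ := h.exists_represents hΩ hθ
  have key (x t u f : ℝ) (hx : 0 < x) (ux uxx : ℝ) :
      (C.φ x - C.τ₁ t) * (f - drift θ x * ux - x ^ (2 * θ 2) * uxx)
      + x ^ (2 * θ 2) * (C.φ₂ x * u + 2 * C.φ₁ x * ux
        + C.φ x * uxx + C.ψ₂ x - ux * C.ξ₂ x - 2 * uxx * C.ξ₁ x)
      + drift θ x * (C.φ₁ x * u + C.φ x * ux + C.ψ₁ x - ux * C.ξ₁ x)
      + x ^ (2 * θ 2) * (2 * θ 2 * (C.ξ x / x) + 2 * C.e 2 * Real.log x) * uxx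
      + (C.e 0 + C.e 1 * x + θ 1 * C.ξ x - √2 * x ^ θ 3 * (C.e 4
        + θ 4 * (θ 3 * (C.ξ x / x) + C.e 3 * Real.log x))) * ux
      - X (fiberPt θ x t u f) 8 = 0 := by
    -- A constant source suffices, since no derivative of `f` enters any longer.
    have ha := isAdmissible_testSource hθ x u f 0 0 0
    have hs : sectionOf (testFunction x t u ux uxx
        (f - drift θ x * ux - x ^ (2 * θ 2) * uxx) 0)
        (elementsOf θ (testSource x u f 0 0 0)) ![x, t] = fiberPt θ x t u f := by
      rw [sectionOf, graphOf_elementsOf]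
      simp [testFunction, testSource]
    have hu := (contDiff_testFunction x t u ux uxx
      (f - drift θ x * ux - x ^ (2 * θ 2) * uxx) 0).contDiffOn (s := posX 2)
    have hp : ![x, t] ∈ posX 2 := hx
    have b00 := (pd_pd_testFunction x t u ux uxx
      (f - drift θ x * ux - x ^ (2 * θ 2) * uxx) 0 0 ![x, t]).1
    have e := h.equation _ ha _ hu _ hp (by
      rw [hs, b00, pd_zero_testFunction, pd_one_testFunction, equationLHS]
      simp [fiberPt, drift])
    rw [prolongedAction_of_represents h.smooth ha hu
      (fun q _ i => by rw [elementsOf_castSucc]) hC hp, hs, b00, pd_zero_testFunction,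
      pd_one_testFunction] at e
    simpa [testFunction] using e
  refine ⟨C, hC, fun x t hx => ?_, fun x t hx => ?_, fun x t u f hx => ?_⟩
  · have hP := (Real.rpow_pos_of_pos hx (2 * θ 2)).ne'
    exact mul_left_cancel₀ hP (by
      linear_combination key x t 0 0 hx 0 1 - key x t 0 0 hx 0 0)
  · linear_combination key x t 0 0 hx 1 0 - key x t 0 0 hx 0 0
  · linear_combination - key x t u f hx 0 0

end Forward

theorem isEquivalenceOperator_iff {Ω : Set (Fin 5 → ℝ)} (hΩ : IsOpen Ω)
    {X : (Fin 9 → ℝ) → (Fin 9 → ℝ)} :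
    IsEquivalenceOperator Ω X ↔ ContDiffOn ℝ ∞ X (extDomain Ω) ∧
      ∀ θ ∈ Ω, IsFiberSolution θ fun x t u f => X (fiberPt θ x t u f) :=
  ⟨fun h => ⟨h.smooth, fun _ hθ => h.isFiberSolution hΩ hθ⟩,
    fun h => isEquivalenceOperator_of_isFiberSolution h.1 h.2⟩

/-! ### Linearity of the determining equations -/

/-- Linear combination of candidate coefficients. -/
def FiberCoeffs.comb (c d : ℝ) (C D : FiberCoeffs) : FiberCoeffs where
  ξ x := c * C.ξ x + d * D.ξ x
  ξ₁ x := c * C.ξ₁ x + d * D.ξ₁ x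
  ξ₂ x := c * C.ξ₂ x + d * D.ξ₂ x
  τ x := c * C.τ x + d * D.τ x
  τ₁ x := c * C.τ₁ x + d * D.τ₁ x
  φ x := c * C.φ x + d * D.φ x
  φ₁ x := c * C.φ₁ x + d * D.φ₁ x
  φ₂ x := c * C.φ₂ x + d * D.φ₂ x
  ψ x := c * C.ψ x + d * D.ψ x
  ψ₁ x := c * C.ψ₁ x + d * D.ψ₁ x
  ψ₂ x := c * C.ψ₂ x + d * D.ψ₂ x
  e i := c * C.e i + d * D.e i

theorem IsFiberSolution.comb {θ : Fin 5 → ℝ} {Y Z : ℝ → ℝ → ℝ → ℝ → Fin 9 → ℝ}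
    (hY : IsFiberSolution θ Y) (hZ : IsFiberSolution θ Z) (c d : ℝ) :
    IsFiberSolution θ fun x t u f => c • Y x t u f + d • Z x t u f := by
  obtain ⟨C, hC⟩ := hY
  obtain ⟨D, hD⟩ := hZ
  have add {g g' h h' : ℝ → ℝ} {x : ℝ} (hg : HasDerivAt g (g' x) x) (hh : HasDerivAt h (h' x) x) :
      HasDerivAt (fun x => c * g x + d * h x) (c * g' x + d * h' x) x :=
    (hg.const_mul c).fun_add (hh.const_mul d)
  refine ⟨C.comb c d D, ⟨fun x hx => add (hC.ξ_deriv x hx) (hD.ξ_deriv x hx),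
    fun x hx => add (hC.ξ₁_deriv x hx) (hD.ξ₁_deriv x hx),
    fun t => add (hC.τ_deriv t) (hD.τ_deriv t),
    fun x hx => add (hC.φ_deriv x hx) (hD.φ_deriv x hx),
    fun x hx => add (hC.φ₁_deriv x hx) (hD.φ₁_deriv x hx),
    fun x hx => add (hC.ψ_deriv x hx) (hD.ψ_deriv x hx),
    fun x hx => add (hC.ψ₁_deriv x hx) (hD.ψ₁_deriv x hx), fun x t u f hx => ?_,
    fun x t u f hx => ?_, fun x t u f hx => ?_, fun x t u f hx i => ?_⟩,
    fun x t hx => ?_, fun x t hx => ?_, fun x t u f hx => ?_⟩ <;>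
  simp only [FiberCoeffs.comb, Pi.add_apply, Pi.smul_apply, smul_eq_mul]
  · rw [hC.coeff_x _ _ _ _ hx, hD.coeff_x _ _ _ _ hx]
  · rw [hC.coeff_t _ _ _ _ hx, hD.coeff_t _ _ _ _ hx]
  · rw [hC.coeff_u _ _ _ _ hx, hD.coeff_u _ _ _ _ hx]
    ring
  · rw [hC.coeff_param _ _ _ _ hx, hD.coeff_param _ _ _ _ hx]
  · linear_combination c * hC.det_uxx x t hx + d * hD.det_uxx x t hx
  · linear_combination c * hC.det_ux x t hx + d * hD.det_ux x t hx
  · rw [hC.coeff_f _ _ _ _ hx, hD.coeff_f _ _ _ _ hx]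
    ring

theorem IsFiberSolution.smul {θ : Fin 5 → ℝ} {Y : ℝ → ℝ → ℝ → ℝ → Fin 9 → ℝ}
    (hY : IsFiberSolution θ Y) (c : ℝ) : IsFiberSolution θ fun x t u f => c • Y x t u f := by
  simpa using hY.comb hY c 0

theorem IsFiberSolution.add {θ : Fin 5 → ℝ} {Y Z : ℝ → ℝ → ℝ → ℝ → Fin 9 → ℝ}
    (hY : IsFiberSolution θ Y) (hZ : IsFiberSolution θ Z) :
    IsFiberSolution θ fun x t u f => Y x t u f + Z x t u f := by
  simpa using hY.comb hZ 1 1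

theorem IsFiberSolution.congr {θ : Fin 5 → ℝ} {Y Z : ℝ → ℝ → ℝ → ℝ → Fin 9 → ℝ}
    (hY : IsFiberSolution θ Y) (h : ∀ x t u f, 0 < x → Z x t u f = Y x t u f) :
    IsFiberSolution θ Z := by
  obtain ⟨C, hC⟩ := hY
  exact ⟨C, { hC with
    coeff_x := fun x t u f hx => by rw [h x t u f hx, hC.coeff_x x t u f hx]
    coeff_t := fun x t u f hx => by rw [h x t u f hx, hC.coeff_t x t u f hx]
    coeff_u := fun x t u f hx => by rw [h x t u f hx, hC.coeff_u x t u f hx]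
    coeff_param := fun x t u f hx i => by rw [h x t u f hx, hC.coeff_param x t u f hx]
    coeff_f := fun x t u f hx => by rw [h x t u f hx, hC.coeff_f x t u f hx] }⟩

/-! ### Logarithmic monomials -/

/-- A tuple `(a, b, i, j, k)` stands for the function `(a + b log x) (x^γ)^i (x^δ)^j x^k`. -/
abbrev LogMonomial := ℝ × ℝ × ℤ × ℤ × ℤ

noncomputable def LogMonomial.eval (γ δ : ℝ) (m : LogMonomial) (x : ℝ) : ℝ :=
  (m.1 + m.2.1 * Real.log x) * ((x ^ γ) ^ m.2.2.1 * (x ^ δ) ^ m.2.2.2.1 * x ^ m.2.2.2.2)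

/-- With `p = γ i + δ j + k`, the derivative of `(a + b log x) x^p` is `(p a + b + p b log x) x^(p -
1)`. The class is closed under differentiation, so derivatives of `ξ` and `φ` are computed
symbolically. -/
noncomputable def LogMonomial.diff (γ δ : ℝ) (m : LogMonomial) : LogMonomial :=
  ((γ * m.2.2.1 + δ * m.2.2.2.1 + m.2.2.2.2) * m.1 + m.2.1,
    (γ * m.2.2.1 + δ * m.2.2.2.1 + m.2.2.2.2) * m.2.1, m.2.2.1, m.2.2.2.1, m.2.2.2.2 - 1)

theorem LogMonomial.hasDerivAt_eval (γ δ : ℝ) (m : LogMonomial) {x : ℝ} (hx : 0 < x) :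
    HasDerivAt (m.eval γ δ) ((m.diff γ δ).eval γ δ x) x := by
  obtain ⟨a, b, i, j, k⟩ := m
  have z {g : ℝ → ℝ} {g' : ℝ} (n : ℤ) (hg : HasDerivAt g g' x) (h0 : g x ≠ 0) :
      HasDerivAt (fun x => g x ^ n) (n * g x ^ (n - 1) * g') x :=
    (hasDerivAt_zpow n (g x) (Or.inl h0)).comp x hg
  have hγ := (Real.rpow_pos_of_pos hx γ).ne'
  have hδ := (Real.rpow_pos_of_pos hx δ).ne'
  have h1 := z i (Real.hasDerivAt_rpow_const (p := γ) (Or.inl hx.ne')) hγ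
  have h2 := z j (Real.hasDerivAt_rpow_const (p := δ) (Or.inl hx.ne')) hδ
  have h3 := z k (hasDerivAt_id x) hx.ne'
  have h4 := ((Real.hasDerivAt_log hx.ne').const_mul b).const_add a
  refine (h4.fun_mul ((h1.fun_mul h2).fun_mul h3)).congr_deriv ?_
  simp only [LogMonomial.eval, LogMonomial.diff, id, Real.rpow_sub_one hx.ne',
    zpow_sub_one₀ hγ, zpow_sub_one₀ hδ, zpow_sub_one₀ hx.ne']
  field_simp
  ring

/-- A sum of logarithmic monomials. -/
noncomputable def logSum (γ δ : ℝ) (l : List LogMonomial) (x : ℝ) : ℝ :=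
  (l.map fun m => m.eval γ δ x).sum

theorem hasDerivAt_logSum (γ δ : ℝ) (l : List LogMonomial) {x : ℝ} (hx : 0 < x) :
    HasDerivAt (logSum γ δ l) (logSum γ δ (l.map (LogMonomial.diff γ δ)) x) x := by
  induction l with
  | nil => exact hasDerivAt_const x 0
  | cons m l ih =>
    simp only [logSum, List.map_cons, List.sum_cons]
    exact (m.hasDerivAt_eval γ δ hx).fun_add ih

/-- Coefficients `ξ`, `φ` given by sums of logarithmic monomials, with `τ = c t` and `ψ = 0`. -/
noncomputable def FiberCoeffs.ofLogSums (γ δ : ℝ) (lξ lφ : List LogMonomial) (c : ℝ)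
    (e : Fin 5 → ℝ) : FiberCoeffs where
  ξ := logSum γ δ lξ
  ξ₁ := logSum γ δ (lξ.map (LogMonomial.diff γ δ))
  ξ₂ := logSum γ δ ((lξ.map (LogMonomial.diff γ δ)).map (LogMonomial.diff γ δ))
  τ t := c * t
  τ₁ _ := c
  φ := logSum γ δ lφ
  φ₁ := logSum γ δ (lφ.map (LogMonomial.diff γ δ))
  φ₂ := logSum γ δ ((lφ.map (LogMonomial.diff γ δ)).map (LogMonomial.diff γ δ))
  ψ _ := 0
  ψ₁ _ := 0
  ψ₂ _ := 0
  e := e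

theorem FiberCoeffs.represents_ofLogSums {γ δ : ℝ} {lξ lφ : List LogMonomial} {c : ℝ}
    {e : Fin 5 → ℝ} {Z : ℝ → ℝ → ℝ → ℝ → Fin 9 → ℝ}
    (h0 : ∀ x t u f, 0 < x → Z x t u f 0 = logSum γ δ lξ x)
    (h1 : ∀ x t u f, 0 < x → Z x t u f 1 = c * t)
    (h2 : ∀ x t u f, 0 < x → Z x t u f 2 = logSum γ δ lφ x * u)
    (h3 : ∀ x t u f (i : Fin 5), Z x t u f (Fin.natAdd 3 i.castSucc) = e i) :
    (FiberCoeffs.ofLogSums γ δ lξ lφ c e).Represents Z where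
  ξ_deriv _ hx := hasDerivAt_logSum γ δ _ hx
  ξ₁_deriv _ hx := hasDerivAt_logSum γ δ _ hx
  τ_deriv t := ((hasDerivAt_id t).const_mul c).congr_deriv (mul_one c)
  φ_deriv _ hx := hasDerivAt_logSum γ δ _ hx
  φ₁_deriv _ hx := hasDerivAt_logSum γ δ _ hx
  ψ_deriv _ _ := hasDerivAt_const _ _
  ψ₁_deriv _ _ := hasDerivAt_const _ _
  coeff_x := h0
  coeff_t := h1
  coeff_u x t u f hx := by rw [h2 x t u f hx]; exact (add_zero _).symm
  coeff_param x t u f _ i := h3 x t u f i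

/-! ### Powers of `x` in terms of `x^γ` and `x^δ` -/

/-- Integer powers of `x^γ`, `x^δ` and `x` turn identities between real powers into rational
identities. -/
theorem rpow_affine {x : ℝ} (hx : 0 < x) {γ δ r : ℝ} (i j k : ℤ) (h : r = γ * i + δ * j + k) :
    x ^ r = (x ^ γ) ^ i * (x ^ δ) ^ j * x ^ k := by
  rw [h, Real.rpow_add hx, Real.rpow_add hx, Real.rpow_mul hx.le, Real.rpow_mul hx.le]
  simp

/-- The fibre of the field given by a formula in the coordinates. -/
def fiberOf (v : ℝ → ℝ → ℝ → ℝ → ℝ → ℝ → ℝ → ℝ → ℝ → (Fin 9 → ℝ)) (θ : Fin 5 → ℝ)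
    (x t u f : ℝ) : Fin 9 → ℝ :=
  v x t u (θ 0) (θ 1) (θ 2) (θ 3) (θ 4) f

theorem fieldOf_fiberPt (v : ℝ → ℝ → ℝ → ℝ → ℝ → ℝ → ℝ → ℝ → ℝ → (Fin 9 → ℝ))
    (F : (Fin 5 → ℝ) → ℝ) (θ : Fin 5 → ℝ) (x t u f : ℝ) :
    fieldOf v F (fiberPt θ x t u f) = F θ • fiberOf v θ x t u f := by
  rw [fieldOf, params_fiberPt]
  rfl

/-- The powers of `x` occurring in the families. -/
theorem rpow_table {x : ℝ} (hx : 0 < x) (γ δ : ℝ) :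
    x ^ (2 * (1 - γ)) = x ^ 2 / (x ^ γ) ^ 2 ∧
    x ^ (-2 * γ) = 1 / (x ^ γ) ^ 2 ∧
    x ^ (2 * γ) = (x ^ γ) ^ 2 ∧
    x ^ (1 + δ) = x * x ^ δ ∧
    x ^ (1 - 2 * γ) = x / (x ^ γ) ^ 2 ∧
    x ^ (-1 - 2 * γ) = 1 / (x * (x ^ γ) ^ 2) ∧
    x ^ (1 - 2 * γ + δ) = x * x ^ δ / (x ^ γ) ^ 2 ∧
    x ^ (δ - 1 - 2 * γ) = x ^ δ / (x * (x ^ γ) ^ 2) ∧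
    x ^ (-1 + δ) = x ^ δ / x ∧
    x ^ (-1 - γ) = 1 / (x * x ^ γ) ∧
    x ^ (-3 - γ) = 1 / (x ^ 3 * x ^ γ) ∧
    x ^ (2 * (1 + γ)) = x ^ 2 * (x ^ γ) ^ 2 ∧
    x ^ (3 + δ) = x ^ 3 * x ^ δ ∧
    x ^ (1 + 2 * γ) = x * (x ^ γ) ^ 2 ∧
    x ^ (4 * γ) = (x ^ γ) ^ 4 ∧
    x ^ (1 + 2 * γ + δ) = x * (x ^ γ) ^ 2 * x ^ δ ∧
    x ^ (2 + δ) = x ^ 2 * x ^ δ ∧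
    x ^ (2 * (1 + δ)) = x ^ 2 * (x ^ δ) ^ 2 ∧
    x ^ (2 * γ + δ) = (x ^ γ) ^ 2 * x ^ δ ∧
    x ^ (1 + 2 * δ) = x * (x ^ δ) ^ 2 ∧
    x ^ (-2 * (1 + γ)) = 1 / (x ^ 2 * (x ^ γ) ^ 2) := by
  have hγ := (Real.rpow_pos_of_pos hx γ).ne'
  have hx' := hx.ne'
  refine ⟨?_, ?_, ?_, ?_, ?_, ?_, ?_, ?_, ?_, ?_, ?_, ?_, ?_, ?_, ?_, ?_, ?_, ?_, ?_, ?_, ?_⟩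
  · rw [rpow_affine hx (γ := γ) (δ := δ) (-2) 0 2 (by push_cast; ring)]
    simp [field]
  · rw [rpow_affine hx (γ := γ) (δ := δ) (-2) 0 0 (by push_cast; ring)]
    simp [field]
  · rw [rpow_affine hx (γ := γ) (δ := δ) 2 0 0 (by push_cast; ring)]
    simp [field]
  · rw [rpow_affine hx (γ := γ) (δ := δ) 0 1 1 (by push_cast; ring)]
    simp [field]
  · rw [rpow_affine hx (γ := γ) (δ := δ) (-2) 0 1 (by push_cast; ring)]
    simp [field]
  · rw [rpow_affine hx (γ := γ) (δ := δ) (-2) 0 (-1) (by push_cast; ring)]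
    simp [field]
  · rw [rpow_affine hx (γ := γ) (δ := δ) (-2) 1 1 (by push_cast; ring)]
    simp [field]
  · rw [rpow_affine hx (γ := γ) (δ := δ) (-2) 1 (-1) (by push_cast; ring)]
    simp [field]
  · rw [rpow_affine hx (γ := γ) (δ := δ) 0 1 (-1) (by push_cast; ring)]
    simp [field]
  · rw [rpow_affine hx (γ := γ) (δ := δ) (-1) 0 (-1) (by push_cast; ring)]
    simp [field]
  · rw [rpow_affine hx (γ := γ) (δ := δ) (-1) 0 (-3) (by push_cast; ring)]
    simp [field]
  · rw [rpow_affine hx (γ := γ) (δ := δ) 2 0 2 (by push_cast; ring)]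
    simp [field]
  · rw [rpow_affine hx (γ := γ) (δ := δ) 0 1 3 (by push_cast; ring)]
    simp [field]
  · rw [rpow_affine hx (γ := γ) (δ := δ) 2 0 1 (by push_cast; ring)]
    simp [field]
  · rw [rpow_affine hx (γ := γ) (δ := δ) 4 0 0 (by push_cast; ring)]
    simp [field]
  · rw [rpow_affine hx (γ := γ) (δ := δ) 2 1 1 (by push_cast; ring)]
    simp [field]
  · rw [rpow_affine hx (γ := γ) (δ := δ) 0 1 2 (by push_cast; ring)]
    simp [field]
  · rw [rpow_affine hx (γ := γ) (δ := δ) 0 2 2 (by push_cast; ring)]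
    simp [field]
  · rw [rpow_affine hx (γ := γ) (δ := δ) 2 1 0 (by push_cast; ring)]
    simp [field]
  · rw [rpow_affine hx (γ := γ) (δ := δ) 0 2 1 (by push_cast; ring)]
    simp [field]
  · rw [rpow_affine hx (γ := γ) (δ := δ) (-2) 0 (-2) (by push_cast; ring)]
    simp [field]

/-- Pattern for all seven verifications: `ξ` and `φ` are read off the field as logarithmic
monomials, and the determining equations are checked as algebraic identities. Here `ξ = 0` and `φ`
integrates `-2 x^(1 - 2γ)`. -/
theorem isFiberSolution_vec4 {θ : Fin 5 → ℝ} (h₁ : θ 2 ≠ 1) :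
    IsFiberSolution θ (fiberOf vec4 θ) := by
  have n₁ : θ 2 - 1 ≠ 0 := sub_ne_zero.2 h₁
  refine ⟨FiberCoeffs.ofLogSums (θ 2) (θ 3) []
      [(1 / (θ 2 - 1), 0, -2, 0, 2)]
      0 ![0, 4, 0, 0, 0],
    FiberCoeffs.represents_ofLogSums (fun x t u f hx => by simp [fiberOf, vec4, logSum])
      (fun x t u f hx => by simp [fiberOf, vec4]) ?_
      (fun x t u f i => by fin_cases i <;> rfl), ?_, ?_, ?_⟩
  all_goals
    intro x
    intros
    rename_i hx
    have hs : √2 ^ 2 = 2 := Real.sq_sqrt zero_le_two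
    have hx' := hx.ne'
    have hγ := (Real.rpow_pos_of_pos hx (θ 2)).ne'
    simp only [fiberOf, vec4, FiberCoeffs.ofLogSums, drift, logSum, LogMonomial.eval,
      LogMonomial.diff, List.map_cons, List.map_nil, List.sum_cons, List.sum_nil, Matrix.cons_val,
      rpow_table hx (θ 2) (θ 3)]
    -- From here `x^γ`, `x^δ`, `log x` and `√2` are independent indeterminates, subject only to `s²
    -- = 2` and nonvanishing.
    generalize x ^ θ 2 = G at hγ ⊢
    generalize x ^ θ 3 = Q
    generalize Real.log x = L
    generalize √2 = s at hs ⊢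
    try norm_num [zpow_neg, zpow_ofNat]
    try field_simp
    try ring_nf
    try simp only [hs]
    try ring_nf
    try simp

theorem isFiberSolution_vec5 {θ : Fin 5 → ℝ} (h₂ : θ 2 ≠ 1 / 2) :
    IsFiberSolution θ (fiberOf vec5 θ) := by
  have n₂ : 2 * θ 2 - 1 ≠ 0 := fun h => h₂ (by linarith)
  refine ⟨FiberCoeffs.ofLogSums (θ 2) (θ 3) []
      [(1 / (2 * θ 2 - 1), 0, -2, 0, 1)]
      0 ![2, 0, 0, 0, 0],
    FiberCoeffs.represents_ofLogSums (fun x t u f hx => by simp [fiberOf, vec5, logSum])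
      (fun x t u f hx => by simp [fiberOf, vec5]) ?_
      (fun x t u f i => by fin_cases i <;> rfl), ?_, ?_, ?_⟩
  all_goals
    intro x
    intros
    rename_i hx
    have hs : √2 ^ 2 = 2 := Real.sq_sqrt zero_le_two
    have hx' := hx.ne'
    have hγ := (Real.rpow_pos_of_pos hx (θ 2)).ne'
    simp only [fiberOf, vec5, FiberCoeffs.ofLogSums, drift, logSum, LogMonomial.eval,
      LogMonomial.diff, List.map_cons, List.map_nil, List.sum_cons, List.sum_nil, Matrix.cons_val,
      rpow_table hx (θ 2) (θ 3)]
    generalize x ^ θ 2 = G at hγ ⊢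
    generalize x ^ θ 3 = Q
    generalize Real.log x = L
    generalize √2 = s at hs ⊢
    try norm_num [zpow_neg, zpow_ofNat]
    try field_simp
    try ring_nf
    try simp only [hs]
    try ring_nf
    try simp

theorem isFiberSolution_vec6 {θ : Fin 5 → ℝ} (h₃ : θ 3 ≠ 2 * θ 2 - 1) :
    IsFiberSolution θ (fiberOf vec6 θ) := by
  have n₃ : 1 - 2 * θ 2 + θ 3 ≠ 0 := fun h => h₃ (by linarith)
  have n₃' : θ 3 + 1 - 2 * θ 2 ≠ 0 := fun h => h₃ (by linarith)
  refine ⟨FiberCoeffs.ofLogSums (θ 2) (θ 3) []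
      [(√2 / (1 - 2 * θ 2 + θ 3), 0, -2, 1, 1)]
      0 ![0, 0, 0, 0, 2],
    FiberCoeffs.represents_ofLogSums (fun x t u f hx => by simp [fiberOf, vec6, logSum])
      (fun x t u f hx => by simp [fiberOf, vec6]) ?_
      (fun x t u f i => by fin_cases i <;> rfl), ?_, ?_, ?_⟩
  all_goals
    intro x
    intros
    rename_i hx
    have hs : √2 ^ 2 = 2 := Real.sq_sqrt zero_le_two
    have hx' := hx.ne'
    have hγ := (Real.rpow_pos_of_pos hx (θ 2)).ne'
    simp only [fiberOf, vec6, FiberCoeffs.ofLogSums, drift, logSum, LogMonomial.eval,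
      LogMonomial.diff, List.map_cons, List.map_nil, List.sum_cons, List.sum_nil, Matrix.cons_val,
      rpow_table hx (θ 2) (θ 3)]
    generalize x ^ θ 2 = G at hγ ⊢
    generalize x ^ θ 3 = Q
    generalize Real.log x = L
    generalize √2 = s at hs ⊢
    try norm_num [zpow_neg, zpow_ofNat]
    try field_simp
    try ring_nf
    try simp only [hs]
    try ring_nf
    try simp

/-- Varying the exponent `δ` gives `φ' = √2 lam x^(K - 1) log x`, whose primitive contains both `x^K
log x / K` and `-x^K / K²`. -/
theorem isFiberSolution_vec7 {θ : Fin 5 → ℝ} (h₃ : θ 3 ≠ 2 * θ 2 - 1) :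
    IsFiberSolution θ (fiberOf vec7 θ) := by
  have n₃ : 1 - 2 * θ 2 + θ 3 ≠ 0 := fun h => h₃ (by linarith)
  refine ⟨FiberCoeffs.ofLogSums (θ 2) (θ 3) []
      [(-(√2 * θ 4) / (1 - 2 * θ 2 + θ 3) ^ 2, √2 * θ 4 / (1 - 2 * θ 2 + θ 3), -2, 1, 1)]
      0 ![0, 0, 0, 2, 0],
    FiberCoeffs.represents_ofLogSums (fun x t u f hx => by simp [fiberOf, vec7, logSum])
      (fun x t u f hx => by simp [fiberOf, vec7]) ?_
      (fun x t u f i => by fin_cases i <;> rfl), ?_, ?_, ?_⟩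
  all_goals
    intro x
    intros
    rename_i hx
    have hs : √2 ^ 2 = 2 := Real.sq_sqrt zero_le_two
    have hx' := hx.ne'
    have hγ := (Real.rpow_pos_of_pos hx (θ 2)).ne'
    simp only [fiberOf, vec7, FiberCoeffs.ofLogSums, drift, logSum, LogMonomial.eval,
      LogMonomial.diff, List.map_cons, List.map_nil, List.sum_cons, List.sum_nil, Matrix.cons_val,
      rpow_table hx (θ 2) (θ 3)]
    generalize x ^ θ 2 = G at hγ ⊢
    generalize x ^ θ 3 = Q
    generalize Real.log x = L
    generalize √2 = s at hs ⊢
    try norm_num [zpow_neg, zpow_ofNat]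
    try field_simp
    try ring_nf
    try simp only [hs]
    try ring_nf
    try simp

/-- For `e = 0` the `u_x` equation integrates to `φ = (ξ' - x^(-2γ) b ξ) / 2` up to a constant. Here
`ξ = 2 x^γ` is the homogeneous solution, and no exponent has to be excluded. -/
theorem isFiberSolution_vec8 {θ : Fin 5 → ℝ} :
    IsFiberSolution θ (fiberOf vec8 θ) := by
  refine ⟨FiberCoeffs.ofLogSums (θ 2) (θ 3) [(2, 0, 1, 0, 0)]
      [(θ 2, 0, 1, 0, -1),
       (√2 * θ 4, 0, -1, 1, 0),
       (-θ 0, 0, -1, 0, 0),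
       (-θ 1, 0, -1, 0, 1)]
      0 0,
    FiberCoeffs.represents_ofLogSums ?_
      (fun x t u f hx => by simp [fiberOf, vec8]) ?_
      (fun x t u f i => by fin_cases i <;> rfl), ?_, ?_, ?_⟩
  all_goals
    intro x
    intros
    rename_i hx
    have hs : √2 ^ 2 = 2 := Real.sq_sqrt zero_le_two
    have hx' := hx.ne'
    have hγ := (Real.rpow_pos_of_pos hx (θ 2)).ne'
    simp only [fiberOf, vec8, FiberCoeffs.ofLogSums, drift, logSum, LogMonomial.eval,
      LogMonomial.diff, List.map_cons, List.map_nil, List.sum_cons, List.sum_nil, Matrix.cons_val,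
      Pi.zero_apply, rpow_table hx (θ 2) (θ 3)]
    generalize x ^ θ 2 = G at hγ ⊢
    generalize x ^ θ 3 = Q
    generalize Real.log x = L
    generalize √2 = s at hs ⊢
    try norm_num [zpow_neg, zpow_ofNat]
    try field_simp
    try ring_nf
    try simp only [hs]
    try ring_nf

/-- The scaling `τ = 4 t` forces `ξ' - γ ξ / x = 2`, solved by a multiple of `x` because `γ ≠ 1`.
The constant `4` in `φ` is a normalisation that the second family could absorb. -/
theorem isFiberSolution_vec9 {θ : Fin 5 → ℝ} (h₁ : θ 2 ≠ 1) :
    IsFiberSolution θ (fiberOf vec9 θ) := by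
  have n₁ : θ 2 - 1 ≠ 0 := sub_ne_zero.2 h₁
  have n₁' : 1 - θ 2 ≠ 0 := sub_ne_zero.2 h₁.symm
  refine ⟨FiberCoeffs.ofLogSums (θ 2) (θ 3) [(-2 / (θ 2 - 1), 0, 0, 0, 1)]
      [(θ 0 / (θ 2 - 1), 0, -2, 0, 1),
       (θ 1 / (θ 2 - 1), 0, -2, 0, 2),
       (4, 0, 0, 0, 0),
       (-(√2 * θ 4) / (θ 2 - 1), 0, -2, 1, 1)]
      4 0,
    FiberCoeffs.represents_ofLogSums ?_
      (fun x t u f hx => by simp [fiberOf, vec9]) ?_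
      (fun x t u f i => by fin_cases i <;> rfl), ?_, ?_, ?_⟩
  all_goals
    intro x
    intros
    rename_i hx
    have hs : √2 ^ 2 = 2 := Real.sq_sqrt zero_le_two
    have hx' := hx.ne'
    have hγ := (Real.rpow_pos_of_pos hx (θ 2)).ne'
    simp only [fiberOf, vec9, FiberCoeffs.ofLogSums, drift, logSum, LogMonomial.eval,
      LogMonomial.diff, List.map_cons, List.map_nil, List.sum_cons, List.sum_nil, Matrix.cons_val,
      Pi.zero_apply, rpow_table hx (θ 2) (θ 3)]
    generalize x ^ θ 2 = G at hγ ⊢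
    generalize x ^ θ 3 = Q
    generalize Real.log x = L
    generalize √2 = s at hs ⊢
    try norm_num [zpow_neg, zpow_ofNat]
    try field_simp
    try ring_nf
    try simp only [hs]
    try ring_nf

-- Varying `γ` gives `ξ' - γ ξ / x = 4 log x`, solved by `x (A + B log x)` with `B = -4 / (γ - 1)`
-- and `A = -4 / (γ - 1)²`. The drift terms with `α`, `β`, `lam` contribute to `φ` separately, and
-- `ξ'' / 2` contributes the bare logarithm.
set_option maxRecDepth 10000 in
set_option maxHeartbeats 2000000 in
theorem isFiberSolution_vec10 {θ : Fin 5 → ℝ} (h₁ : θ 2 ≠ 1) (h₂ : θ 2 ≠ 1 / 2)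
    (h₃ : θ 3 ≠ 2 * θ 2 - 1) :
    IsFiberSolution θ (fiberOf vec10 θ) := by
  have n₁ : θ 2 - 1 ≠ 0 := sub_ne_zero.2 h₁
  have n₂ : 2 * θ 2 - 1 ≠ 0 := fun h => h₂ (by linarith)
  have n₂' : θ 2 * 2 - 1 ≠ 0 := fun h => h₂ (by linarith)
  have n₃' : 1 - θ 2 * 2 + θ 3 ≠ 0 := fun h => h₃ (by linarith)
  have n₃ : 1 - 2 * θ 2 + θ 3 ≠ 0 := fun h => h₃ (by linarith)
  refine ⟨FiberCoeffs.ofLogSums (θ 2) (θ 3) [(-4 / (θ 2 - 1) ^ 2, -4 / (θ 2 - 1), 0, 0, 1)]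
      [(2 * θ 0 * (2 * θ 2 ^ 2 - 1) / ((2 * θ 2 - 1) ^ 2 * (θ 2 - 1) ^ 2),
        2 * θ 0 / ((2 * θ 2 - 1) * (θ 2 - 1)), -2, 0, 1),
       (θ 1 / (θ 2 - 1) ^ 2, 0, -2, 0, 2),
       (-(2 * √2 * (2 * θ 2 ^ 2 + θ 3 * (2 - 4 * θ 2 + θ 3) - 1) * θ 4)
          / ((θ 2 - 1) ^ 2 * (1 - 2 * θ 2 + θ 3) ^ 2),
        -(2 * √2 * (θ 3 - 1) * θ 4) / ((θ 2 - 1) * (1 - 2 * θ 2 + θ 3)), -2, 1, 1),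
       (0, -2 / (θ 2 - 1), 0, 0, 0)]
      0 ![0, 0, 4, 0, 0],
    FiberCoeffs.represents_ofLogSums ?_
      (fun x t u f hx => by simp [fiberOf, vec10]) ?_
      (fun x t u f i => by fin_cases i <;> rfl), ?_, ?_, ?_⟩
  all_goals
    intro x
    intros
    rename_i hx
    have hs : √2 ^ 2 = 2 := Real.sq_sqrt zero_le_two
    have hx' := hx.ne'
    have hγ := (Real.rpow_pos_of_pos hx (θ 2)).ne'
    simp only [fiberOf, vec10, FiberCoeffs.ofLogSums, drift, logSum, LogMonomial.eval,
      LogMonomial.diff, List.map_cons, List.map_nil, List.sum_cons, List.sum_nil, Matrix.cons_val,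
      rpow_table hx (θ 2) (θ 3)]
    generalize x ^ θ 2 = G at hγ ⊢
    generalize x ^ θ 3 = Q
    generalize Real.log x = L
    generalize √2 = s at hs ⊢
    try norm_num [zpow_neg, zpow_ofNat]
    try field_simp
    try ring_nf
    try simp only [hs]
    try ring_nf

/-! ### The remaining families -/

theorem isFiberSolution_time (θ : Fin 5 → ℝ) :
    IsFiberSolution θ fun _ _ _ _ => ![0, 1, 0, 0, 0, 0, 0, 0, 0] := by
  refine ⟨⟨0, 0, 0, 1, 0, 0, 0, 0, 0, 0, 0, 0⟩, ⟨fun x _ => hasDerivAt_const x 0,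
    fun x _ => hasDerivAt_const x 0, fun x => hasDerivAt_const x 1,
    fun x _ => hasDerivAt_const x 0, fun x _ => hasDerivAt_const x 0,
    fun x _ => hasDerivAt_const x 0, fun x _ => hasDerivAt_const x 0,
    fun x t u f _ => rfl, fun x t u f _ => rfl, fun x t u f _ => ?_,
    fun x t u f _ i => by fin_cases i <;> rfl⟩, fun x t _ => ?_, fun x t _ => ?_,
    fun x t u f _ => ?_⟩ <;> simp

theorem isFiberSolution_scaling (θ : Fin 5 → ℝ) :
    IsFiberSolution θ fun _ _ u f => ![0, 0, u, 0, 0, 0, 0, 0, f] := by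
  refine ⟨⟨0, 0, 0, 0, 0, 1, 0, 0, 0, 0, 0, 0⟩, ⟨fun x _ => hasDerivAt_const x 0,
    fun x _ => hasDerivAt_const x 0, fun x => hasDerivAt_const x 0,
    fun x _ => hasDerivAt_const x 1, fun x _ => hasDerivAt_const x 0,
    fun x _ => hasDerivAt_const x 0, fun x _ => hasDerivAt_const x 0,
    fun x t u f _ => rfl, fun x t u f _ => rfl, fun x t u f _ => ?_,
    fun x t u f _ i => by fin_cases i <;> rfl⟩, fun x t _ => ?_, fun x t _ => ?_,
    fun x t u f _ => ?_⟩ <;> simp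

theorem isFiberSolution_field3 {Ω : Set (Fin 5 → ℝ)} {F : ℝ × (Fin 5 → ℝ) → ℝ}
    (hF : ContDiffOn ℝ ∞ F (Set.Ioi 0 ×ˢ Ω)) {θ : Fin 5 → ℝ} (hθ : θ ∈ Ω) :
    IsFiberSolution θ fun x t u f => field3 F (fiberPt θ x t u f) := by
  have h : ContDiffOn ℝ ∞ (fun x => F (x, θ)) (Set.Ioi 0) :=
    hF.comp (contDiff_id.prodMk contDiff_const).contDiffOn fun x hx => ⟨hx, hθ⟩
  refine ⟨⟨0, 0, 0, 0, 0, 0, 0, 0, _, _, _, 0⟩, ⟨fun x _ => hasDerivAt_const x 0,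
    fun x _ => hasDerivAt_const x 0, fun x => hasDerivAt_const x 0,
    fun x _ => hasDerivAt_const x 0, fun x _ => hasDerivAt_const x 0,
    fun x hx => (hasDerivAt_deriv_Ioi h hx).1, fun x hx => (hasDerivAt_deriv_Ioi h hx).2,
    fun x t u f _ => rfl, fun x t u f _ => rfl, fun x t u f _ => ?_,
    fun x t u f _ i => by fin_cases i <;> rfl⟩, fun x t _ => ?_, fun x t _ => ?_,
    fun x t u f _ => ?_⟩
  · simp [field3]
    simp [fiberPt]
  · simp
  · simp
  · simp only [field3, params_fiberPt]
    simp [fiberPt, drift]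
    ring

/-! ### Smoothness of the families -/

theorem contDiffOn_comp_params {Ω : Set (Fin 5 → ℝ)} {F : (Fin 5 → ℝ) → ℝ}
    (hF : ContDiffOn ℝ ∞ F Ω) : ContDiffOn ℝ ∞ (fun z => F (params z)) (extDomain Ω) :=
  hF.comp contDiff_params.contDiffOn fun _ hz => hz.2

/-- Real powers are jointly smooth in base and exponent where `x ≠ 0`, and the conditions on `Ω`
keep all denominators away from zero. -/
theorem contDiffOn_vecs {Ω : Set (Fin 5 → ℝ)}
    (hgen : ∀ θ ∈ Ω, θ 2 ≠ 1 ∧ θ 2 ≠ 1 / 2 ∧ θ 3 ≠ 2 * θ 2 - 1) :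
    ∀ v ∈ ({vec4, vec5, vec6, vec7, vec8, vec9, vec10} :
        Set (ℝ → ℝ → ℝ → ℝ → ℝ → ℝ → ℝ → ℝ → ℝ → (Fin 9 → ℝ))),
      ContDiffOn ℝ ∞ (atPoint v) (extDomain Ω) := by
  intro v hv z hz
  refine ContDiffAt.contDiffWithinAt ?_
  have hx : z 0 ≠ 0 := hz.1.ne'
  obtain ⟨h₁, h₂, h₃⟩ := hgen _ hz.2
  change z 5 ≠ 1 at h₁
  change z 5 ≠ 1 / 2 at h₂
  change z 6 ≠ 2 * z 5 - 1 at h₃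
  have n₁ : z 5 - 1 ≠ 0 := sub_ne_zero.2 h₁
  have n₁' : 1 - z 5 ≠ 0 := sub_ne_zero.2 h₁.symm
  have n₂ : 2 * z 5 - 1 ≠ 0 := fun h => h₂ (by linarith)
  have n₃ : 1 - 2 * z 5 + z 6 ≠ 0 := fun h => h₃ (by linarith)
  have n₃' : z 6 + 1 - 2 * z 5 ≠ 0 := fun h => h₃ (by linarith)
  have n₁₂ : (z 5 - 1) ^ 2 ≠ 0 := pow_ne_zero 2 n₁
  have n₃₂ : (1 - 2 * z 5 + z 6) ^ 2 ≠ 0 := pow_ne_zero 2 n₃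
  have n₁₂₃ : (2 * z 5 - 1) ^ 2 * (z 5 - 1) ^ 2 * (1 - 2 * z 5 + z 6) ^ 2 ≠ 0 :=
    mul_ne_zero (mul_ne_zero (pow_ne_zero 2 n₂) n₁₂) n₃₂
  have c (i : Fin 9) : ContDiffAt ℝ ∞ (fun z : Fin 9 → ℝ => z i) z := contDiffAt_apply ..
  have c0 := c 0
  have c1 := c 1
  have c2 := c 2
  have c3 := c 3
  have c4 := c 4
  have c5 := c 5
  have c6 := c 6
  have c7 := c 7
  have c8 := c 8
  rw [contDiffAt_pi]
  intro i
  rcases hv with rfl | rfl | rfl | rfl | rfl | rfl | rfl <;> fin_cases i <;>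
  simp only [atPoint, vec4, vec5, vec6, vec7, vec8, vec9, vec10, Matrix.cons_val, Fin.reduceFinMk] <;>
  fun_prop (disch := assumption)

theorem contDiffOn_field3 {Ω : Set (Fin 5 → ℝ)} (hΩ : IsOpen Ω) {F : ℝ × (Fin 5 → ℝ) → ℝ}
    (hF : ContDiffOn ℝ ∞ F (Set.Ioi 0 ×ˢ Ω)) : ContDiffOn ℝ ∞ (field3 F) (extDomain Ω) := by
  have hO : IsOpen (Set.Ioi (0 : ℝ) ×ˢ Ω) := isOpen_Ioi.prod hΩ
  -- The partial derivative in `x` is the full derivative applied to `(1, 0)`, hence smooth jointly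
  -- in `x` and `θ`; this is applied twice.
  have hd {G : ℝ × (Fin 5 → ℝ) → ℝ} (hG : ContDiffOn ℝ ∞ G (Set.Ioi 0 ×ˢ Ω)) :
      ContDiffOn ℝ ∞ (fun p => deriv (fun y => G (y, p.2)) p.1) (Set.Ioi 0 ×ˢ Ω) := by
    have h1 : ContDiffOn ℝ ∞ (fun p => fderiv ℝ G p (1, 0)) (Set.Ioi 0 ×ˢ Ω) :=
      (hG.fderiv_of_isOpen (m := ∞) hO (by simp)).clm_apply contDiffOn_const
    refine h1.congr fun p hp => ?_
    have h2 : HasFDerivAt G (fderiv ℝ G p) (p.1, p.2) :=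
      ((hG.contDiffAt (hO.mem_nhds hp)).differentiableAt (by simp)).hasFDerivAt
    have h3 : HasDerivAt (fun y : ℝ => (y, p.2)) (1, 0) p.1 :=
      (hasDerivAt_id p.1).prodMk (hasDerivAt_const p.1 p.2)
    exact (h2.comp_hasDerivAt p.1 h3).deriv
  have hq : ContDiffOn ℝ ∞ (fun z : Fin 9 → ℝ => (z 0, params z)) (extDomain Ω) :=
    ((contDiff_apply ℝ ℝ (0 : Fin 9)).prodMk contDiff_params).contDiffOn
  have hm : Set.MapsTo (fun z : Fin 9 → ℝ => (z 0, params z)) (extDomain Ω) (Set.Ioi 0 ×ˢ Ω) :=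
    fun z hz => hz
  have f0 : ContDiffOn ℝ ∞ (fun z : Fin 9 → ℝ => F (z 0, params z)) (extDomain Ω) := hF.comp hq hm
  have f1 : ContDiffOn ℝ ∞ (fun z : Fin 9 → ℝ => deriv (fun y => F (y, params z)) (z 0))
    (extDomain Ω) := (hd hF).comp hq hm
  have f2 : ContDiffOn ℝ ∞ (fun z : Fin 9 → ℝ => deriv (deriv fun y => F (y, params z)) (z 0))
    (extDomain Ω) := (hd (hd hF)).comp hq hm
  intro z hz
  have hx : z 0 ≠ 0 := hz.1.ne'
  have hU := (isOpen_extDomain hΩ).mem_nhds hz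
  refine ContDiffAt.contDiffWithinAt ?_
  replace f0 := f0.contDiffAt hU
  replace f1 := f1.contDiffAt hU
  replace f2 := f2.contDiffAt hU
  have c (i : Fin 9) : ContDiffAt ℝ ∞ (fun z : Fin 9 → ℝ => z i) z := contDiffAt_apply ..
  have c0 := c 0
  have c3 := c 3
  have c4 := c 4
  have c5 := c 5
  have c6 := c 6
  have c7 := c 7
  rw [contDiffAt_pi]
  intro i
  fin_cases i <;> simp only [field3, Matrix.cons_val, Fin.reduceFinMk]
  iterate 8 first | exact f0 | fun_prop
  refine ContDiffAt.add (ContDiffAt.mul ?_ f1) (ContDiffAt.mul ?_ f2) <;>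
  fun_prop (disch := assumption)

/-! ### Operators with trivial invariants -/

theorem eq_of_hasDerivAt_zero_Ioi {g : ℝ → ℝ} (hg : ∀ x, 0 < x → HasDerivAt g 0 x) {x : ℝ}
    (hx : 0 < x) : g x = g 1 :=
  isOpen_Ioi.is_const_of_deriv_eq_zero isPreconnected_Ioi
    (fun x hx => (hg x hx).differentiableAt.differentiableWithinAt)
    (fun x hx => (hg x hx).deriv) hx (Set.mem_Ioi.2 one_pos)

theorem deriv_eq_zero_of_eq_zero_Ioi {g : ℝ → ℝ} {g' x : ℝ} (hx : 0 < x)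
    (hg : HasDerivAt g g' x) (h : ∀ x, 0 < x → g x = 0) : g' = 0 :=
  (hg.congr_of_eventuallyEq (eventually_of_mem (Ioi_mem_nhds hx) fun y hy => (h y hy).symm)).unique
    (hasDerivAt_const x 0)

/-- A solution of the determining equations with vanishing `∂_θ` coefficients, vanishing `∂_t`
coefficient at two instants and vanishing `∂_x` coefficient at one point. -/
theorem IsFiberSolution.eq_of_normalized {θ : Fin 5 → ℝ} {Y : ℝ → ℝ → ℝ → ℝ → Fin 9 → ℝ}
    (hY : IsFiberSolution θ Y) (he : ∀ i : Fin 5, Y 1 0 0 0 (Fin.natAdd 3 i.castSucc) = 0)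
    (hξ : Y 1 0 0 0 0 = 0) (hτ₀ : Y 1 0 0 0 1 = 0) (hτ₁ : Y 1 1 0 0 1 = 0) {x : ℝ} (hx : 0 < x)
    (t u f : ℝ) :
    Y x t u f = ![0, 0, (Y 1 0 1 0 2 - Y 1 0 0 0 2) * u + Y x 0 0 0 2, 0, 0, 0, 0, 0,
      (Y 1 0 1 0 2 - Y 1 0 0 0 2) * f + (drift θ x * deriv (fun x => Y x 0 0 0 2) x
        + x ^ (2 * θ 2) * deriv (deriv fun x => Y x 0 0 0 2) x)] := by
  obtain ⟨C, hC⟩ := hY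
  have e0 (i : Fin 5) : C.e i = 0 := by rw [← hC.coeff_param 1 0 0 0 one_pos, he]
  have hτ : ∀ t, C.τ₁ t = C.τ₁ 0 := fun t => by
    linarith [hC.det_uxx 1 t one_pos, hC.det_uxx 1 0 one_pos]
  have t0 : C.τ 0 = 0 := by rw [← hC.coeff_t 1 0 0 0 one_pos, hτ₀]
  have t1 : C.τ 1 = 0 := by rw [← hC.coeff_t 1 1 0 0 one_pos, hτ₁]
  -- As `τ'` is constant, `τ` is affine, and its zeros at `0` and `1` make it vanish.
  have tl (t : ℝ) : C.τ t = C.τ₁ 0 * t := by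
    have hd (t) : HasDerivAt (fun t => C.τ t - C.τ₁ 0 * t) 0 t :=
      ((hC.τ_deriv t).fun_sub ((hasDerivAt_id t).const_mul (C.τ₁ 0))).congr_deriv (by
        rw [hτ t]; ring)
    have := is_const_of_deriv_eq_zero (fun t => (hd t).differentiableAt) (fun t => (hd t).deriv) t 0
    simp only [t0] at this
    linarith
  have tz : C.τ₁ 0 = 0 := by linarith [tl 1]
  have x1 (x : ℝ) (hx : 0 < x) : C.ξ₁ x = θ 2 * (C.ξ x / x) := by
    have := hC.det_uxx x 0 hx
    rw [tz, e0] at this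
    linarith
  have xz (x : ℝ) (hx : 0 < x) : C.ξ x = 0 := by
    -- Integrating factor `x^(-γ)` for `ξ' = γ ξ / x`.
    have hd (x) (hx : 0 < x) : HasDerivAt (fun x => C.ξ x * x ^ (-θ 2)) 0 x := by
      refine ((hC.ξ_deriv x hx).fun_mul
        (Real.hasDerivAt_rpow_const (p := -θ 2) (Or.inl hx.ne'))).congr_deriv ?_
      rw [x1 x hx, Real.rpow_sub_one hx.ne']
      field_simp
      ring
    have h := eq_of_hasDerivAt_zero_Ioi hd hx
    simp only [← hC.coeff_x 1 0 0 0 one_pos, hξ, zero_mul] at h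
    exact (mul_eq_zero.1 h).resolve_right (Real.rpow_pos_of_pos hx _).ne'
  have x1z (x : ℝ) (hx : 0 < x) : C.ξ₁ x = 0 := by rw [x1 x hx, xz x hx]; simp
  have x2z (x : ℝ) (hx : 0 < x) : C.ξ₂ x = 0 :=
    deriv_eq_zero_of_eq_zero_Ioi hx (hC.ξ₁_deriv x hx) x1z
  -- With `ξ`, `τ'` and `e` zero, the `u_x` equation collapses to `2 x^(2γ) φ' = 0`.
  have p1z (x : ℝ) (hx : 0 < x) : C.φ₁ x = 0 := by
    have h := hC.det_ux x 0 hx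
    rw [tz, x1z x hx, x2z x hx, xz x hx] at h
    simp only [e0] at h
    have hP := (Real.rpow_pos_of_pos hx (2 * θ 2)).ne'
    exact mul_left_cancel₀ hP (by linear_combination h / 2)
  have p2z : C.φ₂ x = 0 := deriv_eq_zero_of_eq_zero_Ioi hx (hC.φ₁_deriv x hx) p1z
  have pc : C.φ x = Y 1 0 1 0 2 - Y 1 0 0 0 2 := by
    rw [eq_of_hasDerivAt_zero_Ioi (g := C.φ)
        (fun x hx => (hC.φ_deriv x hx).congr_deriv (p1z x hx)) hx,
      hC.coeff_u _ _ _ _ one_pos, hC.coeff_u _ _ _ _ one_pos]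
    ring
  have hψ (x : ℝ) (hx : 0 < x) : Y x 0 0 0 2 = C.ψ x := by
    rw [hC.coeff_u _ _ _ _ hx]; ring
  have hψ₁ (x : ℝ) (hx : 0 < x) : deriv (fun x => Y x 0 0 0 2) x = C.ψ₁ x :=
    ((hC.ψ_deriv x hx).congr_of_eventuallyEq (eventually_of_mem (Ioi_mem_nhds hx) hψ)).deriv
  have hψ₂ : deriv (deriv fun x => Y x 0 0 0 2) x = C.ψ₂ x :=
    ((hC.ψ₁_deriv x hx).congr_of_eventuallyEq (eventually_of_mem (Ioi_mem_nhds hx) hψ₁)).deriv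
  have hp := hC.coeff_param x t u f hx
  simp only [e0] at hp
  ext i
  fin_cases i
  · exact (hC.coeff_x x t u f hx).trans (xz x hx)
  · exact (hC.coeff_t x t u f hx).trans (by rw [tl, tz, zero_mul]; rfl)
  · exact (hC.coeff_u x t u f hx).trans (by rw [pc, ← hψ x hx]; rfl)
  · exact hp 0
  · exact hp 1
  · exact hp 2
  · exact hp 3
  · exact hp 4
  · refine (hC.coeff_f x t u f hx).trans ?_
    rw [p2z, p1z x hx, hτ t, tz, pc, ← hψ₁ x hx, ← hψ₂]
    simp
    ring

/-! ### Matching an operator with a combination of the families. -/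

theorem contDiff_fiberPt_param (x t u f : ℝ) : ContDiff ℝ ∞ fun θ => fiberPt θ x t u f := by
  rw [contDiff_pi]
  intro i
  fin_cases i <;> first | exact contDiff_const | exact contDiff_apply ℝ ℝ _

theorem contDiffOn_at_fiberPt {Ω : Set (Fin 5 → ℝ)} {X : (Fin 9 → ℝ) → (Fin 9 → ℝ)}
    (hX : ContDiffOn ℝ ∞ X (extDomain Ω)) {x : ℝ} (hx : 0 < x) (t u f : ℝ) (i : Fin 9) :
    ContDiffOn ℝ ∞ (fun θ => X (fiberPt θ x t u f) i) Ω :=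
  (contDiffOn_coeff hX i).comp (contDiff_fiberPt_param x t u f).contDiffOn
    fun _ hθ => fiberPt_mem hθ hx _ _ _

/-- The linear combination of the families other than the second and the third one. -/
noncomputable def combination (F₁ F₄ F₅ F₆ F₇ F₈ F₉ F₁₀ : ℝ) (θ : Fin 5 → ℝ) (x t u f : ℝ) :
    Fin 9 → ℝ :=
  F₁ • ![0, 1, 0, 0, 0, 0, 0, 0, 0] + F₄ • fiberOf vec4 θ x t u f + F₅ • fiberOf vec5 θ x t u f
    + F₆ • fiberOf vec6 θ x t u f + F₇ • fiberOf vec7 θ x t u f + F₈ • fiberOf vec8 θ x t u f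
    + F₉ • fiberOf vec9 θ x t u f + F₁₀ • fiberOf vec10 θ x t u f

theorem isFiberSolution_combination {θ : Fin 5 → ℝ}
    (h : θ 2 ≠ 1 ∧ θ 2 ≠ 1 / 2 ∧ θ 3 ≠ 2 * θ 2 - 1) (F₁ F₄ F₅ F₆ F₇ F₈ F₉ F₁₀ : ℝ) :
    IsFiberSolution θ (combination F₁ F₄ F₅ F₆ F₇ F₈ F₉ F₁₀ θ) :=
  ((((((((isFiberSolution_time θ).smul F₁).add ((isFiberSolution_vec4 h.1).smul F₄)).add
    ((isFiberSolution_vec5 h.2.1).smul F₅)).add ((isFiberSolution_vec6 h.2.2).smul F₆)).add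
    ((isFiberSolution_vec7 h.2.2).smul F₇)).add (isFiberSolution_vec8.smul F₈)).add
    ((isFiberSolution_vec9 h.1).smul F₉)).add ((isFiberSolution_vec10 h.1 h.2.1 h.2.2).smul F₁₀)

section Combination

variable (F₁ F₄ F₅ F₆ F₇ F₈ F₉ F₁₀ : ℝ) (θ : Fin 5 → ℝ) (x t u f : ℝ)

theorem combination_x : combination F₁ F₄ F₅ F₆ F₇ F₈ F₉ F₁₀ θ x t u f 0 =
    F₈ * fiberOf vec8 θ x t u f 0 + F₉ * fiberOf vec9 θ x t u f 0
      + F₁₀ * fiberOf vec10 θ x t u f 0 := by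
  have h4 : fiberOf vec4 θ x t u f 0 = 0 := rfl
  have h5 : fiberOf vec5 θ x t u f 0 = 0 := rfl
  have h6 : fiberOf vec6 θ x t u f 0 = 0 := rfl
  have h7 : fiberOf vec7 θ x t u f 0 = 0 := rfl
  simp only [combination, Pi.add_apply, Pi.smul_apply, smul_eq_mul, Matrix.cons_val, h4, h5, h6, h7]
  ring

theorem combination_t :
    combination F₁ F₄ F₅ F₆ F₇ F₈ F₉ F₁₀ θ x t u f 1 = F₁ + F₉ * (4 * t) := by
  have h4 : fiberOf vec4 θ x t u f 1 = 0 := rfl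
  have h5 : fiberOf vec5 θ x t u f 1 = 0 := rfl
  have h6 : fiberOf vec6 θ x t u f 1 = 0 := rfl
  have h7 : fiberOf vec7 θ x t u f 1 = 0 := rfl
  have h8 : fiberOf vec8 θ x t u f 1 = 0 := rfl
  have h9 : fiberOf vec9 θ x t u f 1 = 4 * t := rfl
  have h10 : fiberOf vec10 θ x t u f 1 = 0 := rfl
  simp only [combination, Pi.add_apply, Pi.smul_apply, smul_eq_mul, Matrix.cons_val, h4, h5, h6,
    h7, h8, h9, h10]
  ring

theorem combination_u : combination F₁ F₄ F₅ F₆ F₇ F₈ F₉ F₁₀ θ x t u f 2 =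
    F₄ * fiberOf vec4 θ x t u f 2 + F₅ * fiberOf vec5 θ x t u f 2
      + F₆ * fiberOf vec6 θ x t u f 2 + F₇ * fiberOf vec7 θ x t u f 2
      + F₈ * fiberOf vec8 θ x t u f 2 + F₉ * fiberOf vec9 θ x t u f 2
      + F₁₀ * fiberOf vec10 θ x t u f 2 := by
  simp only [combination, Pi.add_apply, Pi.smul_apply, smul_eq_mul, Matrix.cons_val]
  ring

/-- The `∂_u` components are homogeneous in `u`, so subtracting the combination leaves `ψ` untouched
for the third family. -/
theorem combination_u_zero : combination F₁ F₄ F₅ F₆ F₇ F₈ F₉ F₁₀ θ x t 0 f 2 = 0 := by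
  have h4 : fiberOf vec4 θ x t 0 f 2 = 0 := by simp [fiberOf, vec4]
  have h5 : fiberOf vec5 θ x t 0 f 2 = 0 := by simp [fiberOf, vec5]
  have h6 : fiberOf vec6 θ x t 0 f 2 = 0 := by simp [fiberOf, vec6]
  have h7 : fiberOf vec7 θ x t 0 f 2 = 0 := by simp [fiberOf, vec7]
  have h8 : fiberOf vec8 θ x t 0 f 2 = 0 := by simp [fiberOf, vec8]
  have h9 : fiberOf vec9 θ x t 0 f 2 = 0 := by simp [fiberOf, vec9]
  have h10 : fiberOf vec10 θ x t 0 f 2 = 0 := by simp [fiberOf, vec10]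
  simp [combination_u, h4, h5, h6, h7, h8, h9, h10]

/-- Each parameter direction is moved by exactly one family, so five of the coefficients can be read
off directly. -/
theorem combination_param (i : Fin 5) :
    combination F₁ F₄ F₅ F₆ F₇ F₈ F₉ F₁₀ θ x t u f (Fin.natAdd 3 i.castSucc) =
      ![2 * F₅, 4 * F₄, 4 * F₁₀, 2 * F₇, 2 * F₆] i := by
  have h1 : (![0, 1, 0, 0, 0, 0, 0, 0, 0] : Fin 9 → ℝ) (Fin.natAdd 3 i.castSucc) = 0 := by
    fin_cases i <;> rfl
  have h4 : fiberOf vec4 θ x t u f (Fin.natAdd 3 i.castSucc) = ![0, 4, 0, 0, 0] i := by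
    fin_cases i <;> rfl
  have h5 : fiberOf vec5 θ x t u f (Fin.natAdd 3 i.castSucc) = ![2, 0, 0, 0, 0] i := by
    fin_cases i <;> rfl
  have h6 : fiberOf vec6 θ x t u f (Fin.natAdd 3 i.castSucc) = ![0, 0, 0, 0, 2] i := by
    fin_cases i <;> rfl
  have h7 : fiberOf vec7 θ x t u f (Fin.natAdd 3 i.castSucc) = ![0, 0, 0, 2, 0] i := by
    fin_cases i <;> rfl
  have h8 : fiberOf vec8 θ x t u f (Fin.natAdd 3 i.castSucc) = ![0, 0, 0, 0, 0] i := by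
    fin_cases i <;> rfl
  have h9 : fiberOf vec9 θ x t u f (Fin.natAdd 3 i.castSucc) = ![0, 0, 0, 0, 0] i := by
    fin_cases i <;> rfl
  have h10 : fiberOf vec10 θ x t u f (Fin.natAdd 3 i.castSucc) = ![0, 0, 4, 0, 0] i := by
    fin_cases i <;> rfl
  simp only [combination, Pi.add_apply, Pi.smul_apply, smul_eq_mul, h1, h4, h5, h6, h7, h8, h9, h10]
  fin_cases i <;> simp [mul_comm]

end Combination

end BondPricing

open BondPricing in
theorem mainTheorem1 (Ω : Set (Fin 5 → ℝ)) (hΩ : IsOpen Ω)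
    (hgen : ∀ θ ∈ Ω, θ 2 ≠ 1 ∧ θ 2 ≠ 1 / 2 ∧ θ 3 ≠ 2 * θ 2 - 1)
    (X : (Fin 9 → ℝ) → (Fin 9 → ℝ)) :
    X ∈ BondPricing.equivalenceAlgebra Ω ↔
      ∃ (F₁ F₂ : (Fin 5 → ℝ) → ℝ) (F₃ : ℝ × (Fin 5 → ℝ) → ℝ)
        (F₄ F₅ F₆ F₇ F₈ F₉ F₁₀ : (Fin 5 → ℝ) → ℝ),
        ContDiffOn ℝ ∞ F₁ Ω ∧ ContDiffOn ℝ ∞ F₂ Ω ∧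
        ContDiffOn ℝ ∞ F₃ (Set.Ioi 0 ×ˢ Ω) ∧
        ContDiffOn ℝ ∞ F₄ Ω ∧ ContDiffOn ℝ ∞ F₅ Ω ∧ ContDiffOn ℝ ∞ F₆ Ω ∧
        ContDiffOn ℝ ∞ F₇ Ω ∧ ContDiffOn ℝ ∞ F₈ Ω ∧ ContDiffOn ℝ ∞ F₉ Ω ∧
        ContDiffOn ℝ ∞ F₁₀ Ω ∧
        ∀ z ∈ BondPricing.extDomain Ω,
          X z = BondPricing.field1 F₁ z + BondPricing.field2 F₂ z + BondPricing.field3 F₃ z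
            + BondPricing.fieldOf BondPricing.vec4 F₄ z
            + BondPricing.fieldOf BondPricing.vec5 F₅ z
            + BondPricing.fieldOf BondPricing.vec6 F₆ z
            + BondPricing.fieldOf BondPricing.vec7 F₇ z
            + BondPricing.fieldOf BondPricing.vec8 F₈ z
            + BondPricing.fieldOf BondPricing.vec9 F₉ z
            + BondPricing.fieldOf BondPricing.vec10 F₁₀ z := by
  have hvec := contDiffOn_vecs hgen
  -- Families 2 and 3 are kept apart: they are what remains after normalisation.
  have fields_eq (F₁ F₂ : (Fin 5 → ℝ) → ℝ) (F₃ : ℝ × (Fin 5 → ℝ) → ℝ)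
      (F₄ F₅ F₆ F₇ F₈ F₉ F₁₀ : (Fin 5 → ℝ) → ℝ) (θ : Fin 5 → ℝ) (x t u f : ℝ) :
      field1 F₁ (fiberPt θ x t u f) + field2 F₂ (fiberPt θ x t u f)
        + field3 F₃ (fiberPt θ x t u f) + fieldOf vec4 F₄ (fiberPt θ x t u f)
        + fieldOf vec5 F₅ (fiberPt θ x t u f) + fieldOf vec6 F₆ (fiberPt θ x t u f)
        + fieldOf vec7 F₇ (fiberPt θ x t u f) + fieldOf vec8 F₈ (fiberPt θ x t u f)
        + fieldOf vec9 F₉ (fiberPt θ x t u f) + fieldOf vec10 F₁₀ (fiberPt θ x t u f)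
      = combination (F₁ θ) (F₄ θ) (F₅ θ) (F₆ θ) (F₇ θ) (F₈ θ) (F₉ θ) (F₁₀ θ) θ x t u f
        + (F₂ θ • ![0, 0, u, 0, 0, 0, 0, 0, f] + field3 F₃ (fiberPt θ x t u f)) := by
    simp only [fieldOf_fiberPt, field1, field2, params_fiberPt, combination]
    rw [show fiberPt θ x t u f 2 = u from rfl, show fiberPt θ x t u f 8 = f from rfl]
    abel
  rw [equivalenceAlgebra, Set.mem_ofPred_eq, isEquivalenceOperator_iff hΩ]
  constructor
  · rintro ⟨hX, hsol⟩
    have hat (t u : ℝ) (i : Fin 9) : ContDiffOn ℝ ∞ (fun θ => X (fiberPt θ 1 t u 0) i) Ω :=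
      contDiffOn_at_fiberPt hX one_pos t u 0 i
    have hv {v} (h : v ∈ ({vec4, vec5, vec6, vec7, vec8, vec9, vec10} :
        Set (ℝ → ℝ → ℝ → ℝ → ℝ → ℝ → ℝ → ℝ → ℝ → (Fin 9 → ℝ)))) (i : Fin 9) (u : ℝ) :
        ContDiffOn ℝ ∞ (fun θ => fiberOf v θ 1 0 u 0 i) Ω :=
      contDiffOn_at_fiberPt (hvec v h) one_pos 0 u 0 i
    -- The coefficients are read off at `x = 1`, `t = u = f = 0`, divided by the constants `2` or
    -- `4` carried by the fields. `F₉` is a quarter of the slope of `τ`.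
    let F₁ : (Fin 5 → ℝ) → ℝ := fun θ => X (fiberPt θ 1 0 0 0) 1
    let F₄ : (Fin 5 → ℝ) → ℝ := fun θ => X (fiberPt θ 1 0 0 0) 4 / 4
    let F₅ : (Fin 5 → ℝ) → ℝ := fun θ => X (fiberPt θ 1 0 0 0) 3 / 2
    let F₆ : (Fin 5 → ℝ) → ℝ := fun θ => X (fiberPt θ 1 0 0 0) 7 / 2
    let F₇ : (Fin 5 → ℝ) → ℝ := fun θ => X (fiberPt θ 1 0 0 0) 6 / 2
    let F₉ : (Fin 5 → ℝ) → ℝ := fun θ =>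
      (X (fiberPt θ 1 1 0 0) 1 - X (fiberPt θ 1 0 0 0) 1) / 4
    let F₁₀ : (Fin 5 → ℝ) → ℝ := fun θ => X (fiberPt θ 1 0 0 0) 5 / 4
    -- Families 9 and 10 also move `x`, so their share is removed first; family 8 contributes `2 ·
    -- 1^γ = 2`.
    let F₈ : (Fin 5 → ℝ) → ℝ := fun θ => (X (fiberPt θ 1 0 0 0) 0
      - F₉ θ * fiberOf vec9 θ 1 0 0 0 0 - F₁₀ θ * fiberOf vec10 θ 1 0 0 0 0) / 2
    let S (θ : Fin 5 → ℝ) : ℝ → ℝ → ℝ → ℝ → Fin 9 → ℝ :=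
      combination (F₁ θ) (F₄ θ) (F₅ θ) (F₆ θ) (F₇ θ) (F₈ θ) (F₉ θ) (F₁₀ θ) θ
    -- The constant value of `φ` after subtraction, taken at `x = 1` as the difference between `u =
    -- 1` and `u = 0`, where the combination vanishes.
    let F₂ : (Fin 5 → ℝ) → ℝ := fun θ =>
      (X (fiberPt θ 1 0 1 0) 2 - S θ 1 0 1 0 2) - X (fiberPt θ 1 0 0 0) 2
    let F₃ : ℝ × (Fin 5 → ℝ) → ℝ := fun p => X (fiberPt p.2 p.1 0 0 0) 2
    have s₁ : ContDiffOn ℝ ∞ F₁ Ω := hat _ _ _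
    have s₄ : ContDiffOn ℝ ∞ F₄ Ω := (hat _ _ _).div_const _
    have s₅ : ContDiffOn ℝ ∞ F₅ Ω := (hat _ _ _).div_const _
    have s₆ : ContDiffOn ℝ ∞ F₆ Ω := (hat _ _ _).div_const _
    have s₇ : ContDiffOn ℝ ∞ F₇ Ω := (hat _ _ _).div_const _
    have s₉ : ContDiffOn ℝ ∞ F₉ Ω := ((hat _ _ _).sub (hat _ _ _)).div_const _
    have s₁₀ : ContDiffOn ℝ ∞ F₁₀ Ω := (hat _ _ _).div_const _
    have s₈ : ContDiffOn ℝ ∞ F₈ Ω := (((hat _ _ _).sub (s₉.mul (hv (by simp) 0 0))).sub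
      (s₁₀.mul (hv (by simp) 0 0))).div_const _
    have sS : ContDiffOn ℝ ∞ (fun θ => S θ 1 0 1 0 2) Ω := by
      simp only [S, combination_u]
      exact ((((((s₄.mul (hv (by simp) 2 1)).add (s₅.mul (hv (by simp) 2 1))).add
        (s₆.mul (hv (by simp) 2 1))).add (s₇.mul (hv (by simp) 2 1))).add
        (s₈.mul (hv (by simp) 2 1))).add (s₉.mul (hv (by simp) 2 1))).add
        (s₁₀.mul (hv (by simp) 2 1))
    have s₂ : ContDiffOn ℝ ∞ F₂ Ω := ((hat _ _ _).sub sS).sub (hat _ _ _)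
    have s₃ : ContDiffOn ℝ ∞ F₃ (Set.Ioi 0 ×ˢ Ω) := by
      refine (contDiffOn_coeff hX 2).comp (ContDiff.contDiffOn ?_)
        fun p hp => fiberPt_mem hp.2 hp.1 _ _ _
      rw [contDiff_pi]
      intro i
      fin_cases i <;> first
        | exact contDiff_const | exact contDiff_fst | exact contDiff_pi.1 contDiff_snd _
    refine ⟨F₁, F₂, F₃, F₄, F₅, F₆, F₇, F₈, F₉, F₁₀, s₁, s₂, s₃, s₄, s₅, s₆, s₇, s₈, s₉, s₁₀,
      fun z hz => ?_⟩
    obtain ⟨θ, x, t, u, f, hθ, hx, rfl⟩ : ∃ θ x t u f, θ ∈ Ω ∧ 0 < x ∧ fiberPt θ x t u f = z :=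
      ⟨_, _, _, _, _, hz.2, hz.1, fiberPt_params z⟩
    -- The difference of `X` and the combination solves the determining equations, and the choices
    -- above normalise it.
    have hY := (hsol θ hθ).comb (isFiberSolution_combination (hgen θ hθ) (F₁ θ) (F₄ θ) (F₅ θ)
      (F₆ θ) (F₇ θ) (F₈ θ) (F₉ θ) (F₁₀ θ)) 1 (-1)
    have hS0 (x : ℝ) : S θ x 0 0 0 2 = 0 := combination_u_zero ..
    have key := hY.eq_of_normalized (fun i => ?_) ?_ ?_ ?_ hx t u f
    · have hc : ((1 : ℝ) • X (fiberPt θ 1 0 1 0) + (-1 : ℝ) • S θ 1 0 1 0) 2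
          - ((1 : ℝ) • X (fiberPt θ 1 0 0 0) + (-1 : ℝ) • S θ 1 0 0 0) 2 = F₂ θ := by
        simp only [Pi.add_apply, Pi.smul_apply, smul_eq_mul, hS0, F₂]
        ring
      have hψ (x : ℝ) : ((1 : ℝ) • X (fiberPt θ x 0 0 0) + (-1 : ℝ) • S θ x 0 0 0) 2
          = F₃ (x, θ) := by
        simp only [Pi.add_apply, Pi.smul_apply, smul_eq_mul, hS0, F₃]
        ring
      simp only [S] at hc hψ
      rw [hc] at key
      simp only [hψ] at key
      rw [fields_eq, ← sub_eq_iff_eq_add', sub_eq_add_neg]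
      rw [one_smul, neg_one_smul] at key
      rw [key]
      ext i
      fin_cases i <;> simp [field3]
      · simp [fiberPt]
      · rfl
    · have h := combination_param (F₁ θ) (F₄ θ) (F₅ θ) (F₆ θ) (F₇ θ) (F₈ θ) (F₉ θ) (F₁₀ θ) θ
        1 0 0 0 i
      simp only [Pi.add_apply, Pi.smul_apply, smul_eq_mul, h]
      fin_cases i <;> simp [F₄, F₅, F₆, F₇, F₁₀, Fin.natAdd] <;> ring_nf
    · simp only [Pi.add_apply, Pi.smul_apply, smul_eq_mul, combination_x]
      rw [show fiberOf vec8 θ 1 0 0 0 0 = 2 by simp [fiberOf, vec8]]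
      simp only [F₈]
      ring
    · simp only [Pi.add_apply, Pi.smul_apply, smul_eq_mul, combination_t, F₁]
      ring
    · simp only [Pi.add_apply, Pi.smul_apply, smul_eq_mul, combination_t, F₁, F₉]
      ring
  · rintro ⟨F₁, F₂, F₃, F₄, F₅, F₆, F₇, F₈, F₉, F₁₀, s₁, s₂, s₃, s₄, s₅, s₆, s₇, s₈, s₉, s₁₀, h⟩
    constructor
    · have hf {F : (Fin 5 → ℝ) → ℝ} (hF : ContDiffOn ℝ ∞ F Ω) {v}
          (hv : v ∈ ({vec4, vec5, vec6, vec7, vec8, vec9, vec10} :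
            Set (ℝ → ℝ → ℝ → ℝ → ℝ → ℝ → ℝ → ℝ → ℝ → (Fin 9 → ℝ)))) :
          ContDiffOn ℝ ∞ (fieldOf v F) (extDomain Ω) :=
        (contDiffOn_comp_params hF).smul (hvec v hv)
      have f₁ : ContDiffOn ℝ ∞ (field1 F₁) (extDomain Ω) :=
        (contDiffOn_comp_params s₁).smul contDiffOn_const
      have f₂ : ContDiffOn ℝ ∞ (field2 F₂) (extDomain Ω) := by
        refine (contDiffOn_comp_params s₂).smul (ContDiff.contDiffOn ?_)
        rw [contDiff_pi]
        intro i
        fin_cases i <;> first | exact contDiff_const | exact contDiff_apply ℝ ℝ _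
      exact (((((((((f₁.add f₂).add (contDiffOn_field3 hΩ s₃)).add (hf s₄ (by simp))).add
        (hf s₅ (by simp))).add (hf s₆ (by simp))).add (hf s₇ (by simp))).add
        (hf s₈ (by simp))).add (hf s₉ (by simp))).add (hf s₁₀ (by simp))).congr h
    · intro θ hθ
      refine ((isFiberSolution_combination (hgen θ hθ) (F₁ θ) (F₄ θ) (F₅ θ) (F₆ θ) (F₇ θ) (F₈ θ)
        (F₉ θ) (F₁₀ θ)).add (((isFiberSolution_scaling θ).smul (F₂ θ)).add
          (isFiberSolution_field3 s₃ hθ))).congr fun x t u f hx => ?_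
      rw [h _ (fiberPt_mem hθ hx t u f), fields_eq]
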